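/- For $u\in\mathbb R$ let $\Phi(u)=\sum_{n\ge1}(2\pi^2n^4e^{9u}-3\pi n^2e^{5u})\exp(-\pi n^2e^{4u})$, for $t\in\mathbb R$, $z\in\mathbb C$ let $H_t(z)=\int_0^\infty e^{tu^2}\Phi(u)\cos(zu)\,du$, let $H_t'$ denote the derivative of $H_t$ in $z$, and let $\log_+x=\log(2+|x|)$. Let $\Lambda$ be any real number (for instance the de Bruijn–Newman constant). Then there are constants $A>0$ and $C'>0$ depending only on $\Lambda$ such that for every real $C$ there is a constant $K$, depending only on $\Lambda$ and $C$, for which the following holds. Let $\Lambda<t\le0$, $x\ge0$, $0\le\kappa\le C$ and $z=x-i\kappa\log_+x$. Then $$|H_t(z)|\le A\exp\Big(-\frac{\pi x}{8}+K\log_+^2x\Big).$$ If moreover $\kappa\ge C'$, then $$H_t(z)=\exp\Big(-\frac{\pi x}{8}+w\Big)\quad\text{for some } w\in\mathbb C \text{ with } |w|\le K\log_+^2x$$ (in particular $H_t(z)\ne0$), and, if also $x>0$, $$\Big|\frac{H_t'}{H_t}(z)-\frac i4\log\Big(\frac{iz}{4\pi}\Big)\Big|\le K\,\frac{\log_+x}{x},$$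 where $\log$ is the standard branch of the complex logarithm. -/

import Mathlib

namespace DeBruijnNewman

noncomputable section

/-- The super-exponentially decaying function
`Φ(u) = ∑_{n ≥ 1} (2π²n⁴e^{9u} - 3πn²e^{5u}) exp(-πn²e^{4u})`, indexed here by `n + 1`, `n : ℕ`. -/
def Phi (u : ℝ) : ℝ :=
  ∑' n : ℕ,
    (2 * Real.pi ^ 2 * ((n : ℝ) + 1) ^ 4 * Real.exp (9 * u)
        - 3 * Real.pi * ((n : ℝ) + 1) ^ 2 * Real.exp (5 * u))
      * Real.exp (-Real.pi * ((n : ℝ) + 1) ^ 2 * Real.exp (4 * u))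

/-- De Bruijn's family `H_t(z) = ∫_0^∞ e^{tu²} Φ(u) cos(zu) du`. -/
def H (t : ℝ) (z : ℂ) : ℂ :=
  ∫ u in Set.Ioi (0 : ℝ),
    ((Real.exp (t * u ^ 2) * Phi u : ℝ) : ℂ) * Complex.cos (z * (u : ℂ))

/-- The modified logarithm `log₊ x = log (2 + |x|)`. -/
def logPlus (x : ℝ) : ℝ := Real.log (2 + |x|)

end

end DeBruijnNewman

namespace DeBruijnNewman

noncomputable section

open Real Set Filter Topology MeasureTheory

/-! Write $t=-\sigma^2$. Since $\Phi$ is even (`Phi_neg`), $2H_t(z)$ is the two-sided Laplace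
transform of $e^{-\sigma^2u^2}\Phi(u)$ at $iz$. For $t=0$ this transform is `xiLaplace`, an entire
even function which for $\Re w>1$ equals
$\frac{w-1}8\pi^{-(1+w)/4}\Gamma(\frac{5+w}4)\zeta(\frac{1+w}2)$ (`xiLaplace_eq`). The Gaussian
factor averages it over a vertical line, `H_eq_gaussian_average`: $2H_t(z)$ is
$\pi^{-1/2}e^{\sigma^2l^2}\int e^{-r^2-2i\sigma lr}\,\mathrm{xiLaplace}(iz-2\sigma^2l+2i\sigma
r)\,dr$, with $l\in\mathbb C$ at will.

Far to the right, $\zeta$ is close to 1 and Stirling's formula gives a logarithm `logXi` with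
derivative close to $\frac14\log(w/4\pi)$, which varies slowly. For large $\kappa$ take for $l$ the
value `slope` of this function at `base`, the point $iz$. The linear term of `logXi` along the line
then cancels $-2i\sigma lr$, and what is left is a constant times $e^{-r^2+\text{phaseError}}$. The
line stays within $O(\sqrt\kappa\log_+x\,(1+|r|))$ of $iz$ while its real part is at least
$\frac12\kappa\log_+x$, so the error is at most $(1+r^2)/20$ (`norm_phaseError_le`) and the integral
lies within $\sqrt\pi/2$ of $\sqrt\pi$. Hence $H_t(z)\ne0$, with the asserted size
(`abs_log_norm_H_add_le`).

The average for $H_t'$ carries the additional factor `logXi`$'$, which is `slope` up to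
$O((1+r^2)\log_+x/x)$; dividing the two averages gives the logarithmic derivative
(`norm_logDeriv_H_sub_le`).

For small $\kappa$ the line may meet zeros of $\zeta$, but an upper bound suffices. There $l=0$, and
`xiLaplace` is bounded in the strip $|\Re w|\le7$ by the Phragmén–Lindelöf principle, from its
evenness and the bound on $\Re w=7$ (`norm_xiLaplace_le`, `norm_H_le`). -/

/-! ### Theta series and the evenness of $\Phi$. -/

/-- The power-weighted theta sums `∑_{n ≥ 1} n^{2k} exp(-π n² a)`. -/
def thetaMoment (k : ℕ) (a : ℝ) : ℝ :=
  ∑' n : ℕ, ((n : ℝ) + 1) ^ (2 * k) * Real.exp (-π * ((n : ℝ) + 1) ^ 2 * a)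

theorem summable_thetaMoment (k : ℕ) {a : ℝ} (ha : 0 < a) :
    Summable fun n : ℕ => ((n : ℝ) + 1) ^ (2 * k) * Real.exp (-π * ((n : ℝ) + 1) ^ 2 * a) := by
  have h := Real.summable_pow_mul_exp_neg_nat_mul (2 * k) (mul_pos pi_pos ha)
  have h' := (summable_nat_add_iff 1).2 h
  refine Summable.of_nonneg_of_le (fun n => by positivity) (fun n => ?_) h'
  push_cast
  refine mul_le_mul_of_nonneg_left (Real.exp_le_exp.2 ?_) (by positivity)
  have : 0 < π * a := mul_pos pi_pos ha
  have hn : (0 : ℝ) ≤ n := n.cast_nonneg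
  nlinarith [mul_nonneg this.le hn, mul_nonneg (mul_nonneg this.le hn) hn]

theorem hasDerivAt_thetaMoment (k : ℕ) {a : ℝ} (ha : 0 < a) :
    HasDerivAt (thetaMoment k) (-π * thetaMoment (k + 1) a) a := by
  have ha2 : 0 < a / 2 := by positivity
  -- The next moment at $a/2$ dominates the differentiated series on the whole half-line $y>a/2$.
  have hu := (summable_thetaMoment (k + 1) ha2).mul_left π
  have := hasDerivAt_tsum_of_isPreconnected (𝕜 := ℝ) (F := ℝ) hu (isOpen_Ioi (a := a / 2))
    isPreconnected_Ioi
    (g := fun n : ℕ => fun y => ((n : ℝ) + 1) ^ (2 * k) * Real.exp (-π * ((n : ℝ) + 1) ^ 2 * y))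
    (g' := fun n : ℕ => fun y =>
      -π * (((n : ℝ) + 1) ^ (2 * (k + 1)) * Real.exp (-π * ((n : ℝ) + 1) ^ 2 * y)))
    (y₀ := a) (y := a) ?_ ?_ (by simp [ha]) (summable_thetaMoment k ha) (by simp [ha])
  · rw [tsum_mul_left] at this
    exact this
  · intro n y _
    have h1 : HasDerivAt (fun y : ℝ => -π * ((n : ℝ) + 1) ^ 2 * y) (-π * ((n : ℝ) + 1) ^ 2) y := by
      convert! (hasDerivAt_id y).const_mul (-π * ((n : ℝ) + 1) ^ 2) using 1
      ring
    convert! (h1.exp.const_mul (((n : ℝ) + 1) ^ (2 * k))) using 1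
    ring
  · intro n y hy
    have hy' : a / 2 < y := hy
    rw [norm_mul, norm_neg, Real.norm_of_nonneg pi_pos.le, Real.norm_of_nonneg (by positivity)]
    have : 0 ≤ π * ((n : ℝ) + 1) ^ 2 := by positivity
    gcongr π * (_ * Real.exp ?_)
    nlinarith

theorem Phi_eq_thetaMoment (u : ℝ) :
    Phi u = 2 * π ^ 2 * Real.exp (9 * u) * thetaMoment 2 (Real.exp (4 * u))
      - 3 * π * Real.exp (5 * u) * thetaMoment 1 (Real.exp (4 * u)) := by
  have h2 := (summable_thetaMoment 2 (Real.exp_pos (4 * u))).mul_left (2 * π ^ 2 * Real.exp (9 * u))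
  have h1 := (summable_thetaMoment 1 (Real.exp_pos (4 * u))).mul_left (3 * π * Real.exp (5 * u))
  rw [thetaMoment, thetaMoment, ← tsum_mul_left, ← tsum_mul_left, ← h2.tsum_sub h1, Phi]
  refine tsum_congr fun n => ?_
  norm_num
  ring

theorem continuous_Phi : Continuous Phi := by
  have h : ∀ k, Continuous fun u : ℝ => thetaMoment k (Real.exp (4 * u)) := fun k => by
    refine continuous_iff_continuousAt.2 fun u => ?_
    exact ContinuousAt.comp (f := fun u : ℝ => Real.exp (4 * u))
      (hasDerivAt_thetaMoment k (Real.exp_pos _)).continuousAt (by fun_prop)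
  rw [funext Phi_eq_thetaMoment]
  have h1 := h 1
  have h2 := h 2
  fun_prop

theorem tsum_int_exp_eq_thetaMoment {a : ℝ} (ha : 0 < a) :
    ∑' n : ℤ, Real.exp (-π * a * (n : ℝ) ^ 2) = 1 + 2 * thetaMoment 0 a := by
  have hs := summable_thetaMoment 0 ha
  simp only [mul_zero, pow_zero, one_mul] at hs
  have hs' : Summable fun n : ℕ => Real.exp (-π * a * (((n + 1 : ℕ) : ℤ) : ℝ) ^ 2) := by
    refine hs.congr fun n => ?_
    push_cast
    ring_nf
  have e : ∀ n : ℕ, Real.exp (-π * a * ((-((n : ℤ) + 1) : ℤ) : ℝ) ^ 2)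
      = Real.exp (-π * a * (((n + 1 : ℕ) : ℤ) : ℝ) ^ 2) := fun n => by
    push_cast
    ring_nf
  have h1 : Summable fun n : ℕ => Real.exp (-π * a * ((n : ℤ) : ℝ) ^ 2) :=
    (summable_nat_add_iff 1).1 hs'
  have h2 : Summable fun n : ℕ => Real.exp (-π * a * ((-((n : ℤ) + 1) : ℤ) : ℝ) ^ 2) :=
    hs'.congr fun n => (e n).symm
  rw [tsum_of_nat_of_neg_add_one (f := fun n : ℤ => Real.exp (-π * a * (n : ℝ) ^ 2)) h1 h2,
    tsum_congr e, h1.tsum_eq_zero_add]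
  have : ∑' n : ℕ, Real.exp (-π * a * (((n + 1 : ℕ) : ℤ) : ℝ) ^ 2) = thetaMoment 0 a := by
    rw [thetaMoment]
    refine tsum_congr fun n => ?_
    push_cast
    ring_nf
  rw [this]
  simp
  ring

/-- The even function `e^u θ(e^{4u})`. -/
def evenTheta (u : ℝ) : ℝ := Real.exp u * (1 + 2 * thetaMoment 0 (Real.exp (4 * u)))

/-- Jacobi's identity $\theta(1/a)=\sqrt a\,\theta(a)$ at $a=e^{4u}$; the factor $e^u$ symmetrises
it. -/
theorem evenTheta_neg (u : ℝ) : evenTheta (-u) = evenTheta u := by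
  have h := Real.tsum_exp_neg_mul_int_sq (Real.exp_pos (4 * u))
  have e : -π / Real.exp (4 * u) = -π * Real.exp (4 * -u) := by
    rw [mul_neg, Real.exp_neg]; rfl
  rw [e, tsum_int_exp_eq_thetaMoment (Real.exp_pos _), tsum_int_exp_eq_thetaMoment (Real.exp_pos _),
    ← Real.exp_mul] at h
  rw [evenTheta, evenTheta, h, one_div, ← Real.exp_neg, ← mul_assoc, ← Real.exp_add]
  ring_nf

theorem hasDerivAt_thetaMoment_exp (k : ℕ) (u : ℝ) :
    HasDerivAt (fun u : ℝ => thetaMoment k (Real.exp (4 * u)))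
      (-4 * π * Real.exp (4 * u) * thetaMoment (k + 1) (Real.exp (4 * u))) u := by
  have h1 : HasDerivAt (fun u : ℝ => Real.exp (4 * u)) (Real.exp (4 * u) * 4) u := by
    simpa using ((hasDerivAt_id u).const_mul 4).exp
  convert! (hasDerivAt_thetaMoment k (Real.exp_pos (4 * u))).comp u h1 using 1
  ring

theorem hasDerivAt_evenTheta (u : ℝ) :
    HasDerivAt evenTheta (evenTheta u
      - 8 * π * Real.exp (5 * u) * thetaMoment 1 (Real.exp (4 * u))) u := by
  convert! (Real.hasDerivAt_exp u).mul
    (((hasDerivAt_thetaMoment_exp 0 u).const_mul 2).const_add 1) using 1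
  rw [evenTheta, show 5 * u = u + 4 * u by ring, Real.exp_add]
  ring

/-- This exhibits $16\Phi$ as $E''-E$ for the even function $E=$ `evenTheta`, and $E''-E$ inherits
evenness. -/
theorem hasDerivAt_deriv_evenTheta (u : ℝ) :
    HasDerivAt (deriv evenTheta) (evenTheta u + 16 * Phi u) u := by
  rw [funext fun v => (hasDerivAt_evenTheta v).deriv]
  have h1 : HasDerivAt (fun u : ℝ => Real.exp (5 * u)) (Real.exp (5 * u) * 5) u := by
    simpa using ((hasDerivAt_id u).const_mul 5).exp
  convert! (hasDerivAt_evenTheta u).sub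
    ((h1.const_mul (8 * π)).mul (hasDerivAt_thetaMoment_exp 1 u)) using 1
  rw [Phi_eq_thetaMoment, show 9 * u = 5 * u + 4 * u by ring, Real.exp_add]
  ring

theorem Phi_neg (u : ℝ) : Phi (-u) = Phi u := by
  have h0 : (fun u => evenTheta (-u)) = evenTheta := funext evenTheta_neg
  have h1 : ∀ v, deriv evenTheta v = -deriv evenTheta (-v) := fun v => by
    conv_lhs => rw [← h0]
    rw [deriv_comp_neg]
  have h2 : HasDerivAt (deriv evenTheta) (evenTheta (-u) + 16 * Phi (-u)) u := by
    have h := ((hasDerivAt_deriv_evenTheta (-u)).scomp u (hasDerivAt_neg u)).neg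
    rw [funext h1]
    simpa [Function.comp_def] using! h
  have := h2.unique (hasDerivAt_deriv_evenTheta u)
  rw [evenTheta_neg] at this
  linarith

/-! ### The Laplace transform of $\Phi$ in terms of $\Gamma$ and $\zeta$. -/

/-- The substitution $y=e^{4u}$ turns this into Euler's integral for $\Gamma$. -/
theorem integral_cexp_mul_exp_neg_mul_exp {b : ℂ} {c : ℝ} (hb : 0 < b.re) (hc : 0 < c) :
    ∫ u : ℝ, Complex.exp (b * u) * (Real.exp (-(c * Real.exp (4 * u))) : ℝ)
      = 1 / 4 * (1 / (c : ℂ)) ^ (b / 4) * Complex.Gamma (b / 4) := by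
  have hb4 : 0 < (b / 4).re := by
    rw [show b / 4 = b / (4 : ℝ) by norm_num, Complex.div_ofReal_re]; positivity
  have h := Complex.integral_cpow_mul_exp_neg_mul_Ioi hb4 hc
  have himg : (fun u : ℝ => Real.exp (4 * u)) '' univ = Ioi 0 := by
    ext y
    simp only [image_univ, mem_range, mem_Ioi]
    refine ⟨fun ⟨u, hu⟩ => hu ▸ Real.exp_pos _, fun hy => ⟨Real.log y / 4, ?_⟩⟩
    rw [mul_div_cancel₀ _ (by norm_num), Real.exp_log hy]
  have hcv := integral_image_eq_integral_abs_deriv_smul (s := univ)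
    (f := fun u : ℝ => Real.exp (4 * u)) (f' := fun u => Real.exp (4 * u) * 4) MeasurableSet.univ
    (fun u _ => HasDerivAt.hasDerivWithinAt
      (by simpa using ((hasDerivAt_id u).const_mul (4 : ℝ)).exp))
    (fun u _ v _ huv => by have := Real.exp_injective huv; linarith)
    (fun t : ℝ => (t : ℂ) ^ (b / 4 - 1) * Complex.exp (-(c * t)))
  rw [himg, h, setIntegral_univ] at hcv
  rw [mul_assoc, hcv, ← integral_const_mul]
  refine integral_congr_ae (Eventually.of_forall fun u => ?_)
  have hne : ((Real.exp (4 * u) : ℝ) : ℂ) ≠ 0 := Complex.ofReal_ne_zero.2 (Real.exp_pos _).ne'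
  simp only [abs_of_pos (mul_pos (Real.exp_pos (4 * u)) four_pos), Complex.real_smul]
  have e1 : ((Real.exp (4 * u) : ℝ) : ℂ) ^ (b / 4) = Complex.exp (b * u) := by
    rw [Complex.cpow_def_of_ne_zero hne, ← Complex.ofReal_log (Real.exp_pos _).le, Real.log_exp]
    push_cast
    ring_nf
  rw [Complex.cpow_sub _ _ hne, Complex.cpow_one, e1]
  push_cast at hne ⊢
  field_simp

theorem integral_exp_mul_exp_neg_mul_exp {b c : ℝ} (hb : 0 < b) (hc : 0 < c) :
    ∫ u : ℝ, Real.exp (b * u) * Real.exp (-(c * Real.exp (4 * u)))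
      = 1 / 4 * (1 / c) ^ (b / 4) * Real.Gamma (b / 4) := by
  have h := integral_cexp_mul_exp_neg_mul_exp (b := b) (by simpa using hb) hc
  have e : (1 / (c : ℂ)) ^ ((b : ℂ) / 4) = (((1 / c) ^ (b / 4) : ℝ) : ℂ) := by
    rw [Complex.ofReal_cpow (by positivity)]; push_cast; rfl
  rw [e, show ((b : ℂ) / 4) = ((b / 4 : ℝ) : ℂ) by push_cast; rfl, Complex.Gamma_ofReal] at h
  apply Complex.ofReal_injective
  rw [← integral_complex_ofReal]
  push_cast at h ⊢
  exact h

/-- A non-integrable function has integral 0 by convention, so the positive value just computed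
already gives integrability. -/
theorem integrable_exp_mul_exp_neg_mul_exp {b c : ℝ} (hb : 0 < b) (hc : 0 < c) :
    Integrable fun u : ℝ => Real.exp (b * u) * Real.exp (-(c * Real.exp (4 * u))) := by
  refine Integrable.of_integral_ne_zero ?_
  rw [integral_exp_mul_exp_neg_mul_exp hb hc]
  have := Real.Gamma_pos_of_pos (show 0 < b / 4 by positivity)
  positivity

theorem integrable_cexp_mul_exp_neg_mul_exp {b : ℂ} {c : ℝ} (hb : 0 < b.re) (hc : 0 < c) :
    Integrable fun u : ℝ => Complex.exp (b * u) * (Real.exp (-(c * Real.exp (4 * u))) : ℝ) := by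
  refine (integrable_exp_mul_exp_neg_mul_exp hb hc).mono'
    (Continuous.aestronglyMeasurable (by fun_prop)) (Eventually.of_forall fun u => ?_)
  rw [norm_mul, Complex.norm_exp, Complex.norm_real, Real.norm_of_nonneg (Real.exp_pos _).le]
  simp

/-- The `n`-th summand of `Phi`. -/
def phiTerm (n : ℕ) (u : ℝ) : ℝ :=
  (2 * Real.pi ^ 2 * ((n : ℝ) + 1) ^ 4 * Real.exp (9 * u)
        - 3 * Real.pi * ((n : ℝ) + 1) ^ 2 * Real.exp (5 * u))
      * Real.exp (-Real.pi * ((n : ℝ) + 1) ^ 2 * Real.exp (4 * u))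

theorem phiTerm_mul_cexp (n : ℕ) (w : ℂ) (u : ℝ) :
    (phiTerm n u : ℂ) * Complex.exp (w * u)
      = 2 * π ^ 2 * ((n : ℂ) + 1) ^ 4 * (Complex.exp ((9 + w) * u) *
          (Real.exp (-(π * ((n : ℝ) + 1) ^ 2 * Real.exp (4 * u))) : ℝ))
        - 3 * π * ((n : ℂ) + 1) ^ 2 * (Complex.exp ((5 + w) * u) *
          (Real.exp (-(π * ((n : ℝ) + 1) ^ 2 * Real.exp (4 * u))) : ℝ)) := by
  rw [phiTerm, add_mul, add_mul, Complex.exp_add, Complex.exp_add]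
  simp only [neg_mul]
  push_cast
  ring

theorem integrable_phiTerm_mul_cexp (n : ℕ) {w : ℂ} (hw : 1 < w.re) :
    Integrable fun u : ℝ => (phiTerm n u : ℂ) * Complex.exp (w * u) := by
  have hc : 0 < π * ((n : ℝ) + 1) ^ 2 := by positivity
  simp only [phiTerm_mul_cexp]
  exact ((integrable_cexp_mul_exp_neg_mul_exp (by simp; linarith) hc).const_mul _).sub
    ((integrable_cexp_mul_exp_neg_mul_exp (by simp; linarith) hc).const_mul _)

/-- Isolates the dependence on $n$ as a term of the Dirichlet series of $\zeta((1+w)/2)$. -/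
theorem inv_mul_sq_cpow (n : ℕ) (w : ℂ) :
    (π * ((n : ℂ) + 1) ^ 2) * (1 / ((π * ((n : ℝ) + 1) ^ 2 : ℝ) : ℂ)) ^ ((5 + w) / 4)
      = (π : ℂ) ^ (-(1 + w) / 4) * (1 / ((n : ℂ) + 1) ^ ((1 + w) / 2)) := by
  have hN : (0 : ℝ) < (n : ℝ) + 1 := by positivity
  have hNc : ((n : ℂ) + 1) ≠ 0 := by exact_mod_cast hN.ne'
  have hpi : (π : ℂ) ≠ 0 := by exact_mod_cast pi_ne_zero
  have hlog : Complex.log (1 / ((π * ((n : ℝ) + 1) ^ 2 : ℝ) : ℂ))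
      = -(Complex.log π + 2 * Complex.log ((n : ℂ) + 1)) := by
    rw [show (1 / ((π * ((n : ℝ) + 1) ^ 2 : ℝ) : ℂ)) = ((1 / (π * ((n : ℝ) + 1) ^ 2) : ℝ) : ℂ) by
        push_cast; rfl,
      show ((n : ℂ) + 1) = (((n : ℝ) + 1 : ℝ) : ℂ) by push_cast; rfl,
      ← Complex.ofReal_log (by positivity), ← Complex.ofReal_log pi_pos.le,
      ← Complex.ofReal_log hN.le, one_div, Real.log_inv,
      Real.log_mul pi_ne_zero (by positivity), Real.log_pow]
    push_cast
    ring
  have hne : (1 / ((π * ((n : ℝ) + 1) ^ 2 : ℝ) : ℂ)) ≠ 0 :=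
    one_div_ne_zero (Complex.ofReal_ne_zero.2 (by positivity))
  rw [Complex.cpow_def_of_ne_zero hne, hlog, Complex.cpow_def_of_ne_zero hpi,
    Complex.cpow_def_of_ne_zero hNc, one_div, ← Complex.exp_neg, ← Complex.exp_add]
  nth_rw 1 [← Complex.exp_log hpi]
  nth_rw 1 [← Complex.exp_log hNc]
  rw [← Complex.exp_nat_mul, ← Complex.exp_add, ← Complex.exp_add]
  congr 1
  push_cast
  ring

/-- The two exponentials give $\Gamma(s+1)$ and $\Gamma(s)$ with $s=(5+w)/4$; by
$\Gamma(s+1)=s\Gamma(s)$ they combine with coefficient $\frac s2-\frac34=\frac{w-1}8$. -/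
theorem integral_phiTerm_mul_cexp (n : ℕ) {w : ℂ} (hw : 1 < w.re) :
    ∫ u : ℝ, (phiTerm n u : ℂ) * Complex.exp (w * u)
      = (w - 1) / 8 * (π : ℂ) ^ (-(1 + w) / 4) * Complex.Gamma ((5 + w) / 4)
        * (1 / ((n : ℂ) + 1) ^ ((1 + w) / 2)) := by
  have hc : 0 < π * ((n : ℝ) + 1) ^ 2 := by positivity
  have hcc : (π * ((n : ℂ) + 1) ^ 2) ≠ 0 := by exact_mod_cast hc.ne'
  have h9 : 0 < (9 + w).re := by simp; linarith
  have h5 : 0 < (5 + w).re := by simp; linarith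
  simp only [phiTerm_mul_cexp]
  rw [integral_sub ((integrable_cexp_mul_exp_neg_mul_exp h9 hc).const_mul _)
    ((integrable_cexp_mul_exp_neg_mul_exp h5 hc).const_mul _), integral_const_mul,
    integral_const_mul, integral_cexp_mul_exp_neg_mul_exp h9 hc,
    integral_cexp_mul_exp_neg_mul_exp h5 hc]
  have h50 : (5 + w) / 4 ≠ 0 := by
    refine div_ne_zero (fun h => ?_) (by norm_num)
    rw [h] at h5
    simp at h5
  rw [show (9 + w) / 4 = (5 + w) / 4 + 1 by ring, Complex.Gamma_add_one _ h50,
    Complex.cpow_add _ _ (one_div_ne_zero (Complex.ofReal_ne_zero.2 hc.ne')), Complex.cpow_one]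
  have key := inv_mul_sq_cpow n w
  set Q := (1 / ((π * ((n : ℝ) + 1) ^ 2 : ℝ) : ℂ)) ^ ((5 + w) / 4) with hQ
  have e : (1 / ((π * ((n : ℝ) + 1) ^ 2 : ℝ) : ℂ)) * (π * ((n : ℂ) + 1) ^ 2) = 1 := by
    push_cast
    exact one_div_mul_cancel hcc
  rw [show (w - 1) / 8 * (π : ℂ) ^ (-(1 + w) / 4) * Complex.Gamma ((5 + w) / 4)
        * (1 / ((n : ℂ) + 1) ^ ((1 + w) / 2)) = (w - 1) / 8 * Complex.Gamma ((5 + w) / 4) *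
        ((π : ℂ) ^ (-(1 + w) / 4) * (1 / ((n : ℂ) + 1) ^ ((1 + w) / 2))) by ring, ← key]
  linear_combination (2 * π * ((n : ℂ) + 1) ^ 2 * (1 / 4) * Q * ((5 + w) / 4) *
    Complex.Gamma ((5 + w) / 4)) * e

/-- The same computation with the difference replaced by a sum. The bound is summable over $n$
because $(1+\Re w)/2>1$, which justifies integrating the series termwise. -/
theorem integral_norm_phiTerm_mul_cexp_le (n : ℕ) {w : ℂ} (hw : 1 < w.re) :
    ∫ u : ℝ, ‖(phiTerm n u : ℂ) * Complex.exp (w * u)‖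
      ≤ (1 / 4 * ((5 + w.re) / 2 + 3) * π ^ (-(1 + w.re) / 4) * Real.Gamma ((5 + w.re) / 4))
        * (1 / ((n : ℝ) + 1) ^ ((1 + w.re) / 2)) := by
  have hc : 0 < π * ((n : ℝ) + 1) ^ 2 := by positivity
  set a := w.re with ha
  have h9 : 0 < 9 + a := by linarith
  have h5 : 0 < 5 + a := by linarith
  have i9 := integrable_exp_mul_exp_neg_mul_exp h9 hc
  have i5 := integrable_exp_mul_exp_neg_mul_exp h5 hc
  have hle : ∫ u : ℝ, ‖(phiTerm n u : ℂ) * Complex.exp (w * u)‖ ≤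
      ∫ u : ℝ, ((2 * π ^ 2 * ((n : ℝ) + 1) ^ 4) *
        (Real.exp ((9 + a) * u) * Real.exp (-(π * ((n : ℝ) + 1) ^ 2 * Real.exp (4 * u))))
        + (3 * π * ((n : ℝ) + 1) ^ 2) *
        (Real.exp ((5 + a) * u) * Real.exp (-(π * ((n : ℝ) + 1) ^ 2 * Real.exp (4 * u))))) := by
    refine integral_mono (integrable_phiTerm_mul_cexp n hw).norm
      ((i9.const_mul _).add (i5.const_mul _)) fun u => ?_
    simp only [phiTerm_mul_cexp]
    refine (norm_sub_le _ _).trans (le_of_eq ?_)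
    have hn1 : ‖(n : ℂ) + 1‖ = (n : ℝ) + 1 := by
      rw [show (n : ℂ) + 1 = (((n : ℝ) + 1 : ℝ) : ℂ) by push_cast; rfl, Complex.norm_real,
        Real.norm_of_nonneg (by positivity)]
    simp only [norm_mul, norm_pow, Complex.norm_exp, Complex.norm_real, hn1, Real.norm_eq_abs,
      Real.abs_exp, abs_of_pos pi_pos]
    simp [ha]
  refine hle.trans (le_of_eq ?_)
  rw [integral_add (i9.const_mul _) (i5.const_mul _), integral_const_mul,
    integral_const_mul, integral_exp_mul_exp_neg_mul_exp h9 hc,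
    integral_exp_mul_exp_neg_mul_exp h5 hc]
  rw [show (9 + a) / 4 = (5 + a) / 4 + 1 by ring, Real.Gamma_add_one (by positivity),
    Real.rpow_add (by positivity), Real.rpow_one]
  have key : (π * ((n : ℝ) + 1) ^ 2) * (1 / (π * ((n : ℝ) + 1) ^ 2)) ^ ((5 + a) / 4)
      = π ^ (-(1 + a) / 4) * (1 / ((n : ℝ) + 1) ^ ((1 + a) / 2)) := by
    have hN : (0 : ℝ) < (n : ℝ) + 1 := by positivity
    rw [one_div, Real.inv_rpow hc.le, ← Real.rpow_neg hc.le, one_div, ← Real.rpow_neg hN.le]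
    nth_rw 1 [← Real.rpow_one (π * ((n : ℝ) + 1) ^ 2)]
    rw [← Real.rpow_add hc, Real.mul_rpow pi_pos.le (by positivity), ← Real.rpow_natCast,
      ← Real.rpow_mul hN.le]
    congr 2 <;> push_cast <;> ring
  rw [show (1 / 4 * ((5 + a) / 2 + 3) * π ^ (-(1 + a) / 4) * Real.Gamma ((5 + a) / 4))
        * (1 / ((n : ℝ) + 1) ^ ((1 + a) / 2)) = 1 / 4 * ((5 + a) / 2 + 3) *
        Real.Gamma ((5 + a) / 4) * (π ^ (-(1 + a) / 4) * (1 / ((n : ℝ) + 1) ^ ((1 + a) / 2)))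
        by ring, ← key]
  field_simp
  ring

theorem summable_integral_norm_phiTerm {w : ℂ} (hw : 1 < w.re) :
    Summable fun n : ℕ => ∫ u : ℝ, ‖(phiTerm n u : ℂ) * Complex.exp (w * u)‖ := by
  have h : Summable fun n : ℕ => 1 / (((n + 1 : ℕ) : ℝ)) ^ ((1 + w.re) / 2) :=
    (summable_nat_add_iff 1).2 (Real.summable_one_div_nat_rpow.2 (by linarith))
  push_cast at h
  exact Summable.of_nonneg_of_le (fun n => integral_nonneg fun u => norm_nonneg _)
    (fun n => integral_norm_phiTerm_mul_cexp_le n hw) (h.mul_left _)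

theorem integrable_tsum_of_summable_integral_norm {α : Type*} [MeasurableSpace α] {μ : Measure α}
    {F : ℕ → α → ℂ} (hF : ∀ i, Integrable (F i) μ) (hs : Summable fun i => ∫ x, ‖F i x‖ ∂μ)
    (hm : AEStronglyMeasurable (fun x => ∑' i, F i x) μ) :
    Integrable (fun x => ∑' i, F i x) μ := by
  refine ⟨hm, ?_⟩
  calc ∫⁻ x, ‖∑' i, F i x‖ₑ ∂μ ≤ ∫⁻ x, ∑' i, ‖F i x‖ₑ ∂μ :=
        lintegral_mono fun x => enorm_tsum_le_tsum_enorm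
    _ = ∑' i, ∫⁻ x, ‖F i x‖ₑ ∂μ := lintegral_tsum fun i => (hF i).1.enorm
    _ = ∑' i, ENNReal.ofReal (∫ x, ‖F i x‖ ∂μ) := by
        simp_rw [ofReal_integral_norm_eq_lintegral_enorm (hF _)]
    _ < ⊤ := by
        rw [← ENNReal.ofReal_tsum_of_nonneg (fun i => integral_nonneg fun x => norm_nonneg _) hs]
        exact ENNReal.ofReal_lt_top

theorem Phi_mul_cexp_eq_tsum (w : ℂ) (u : ℝ) :
    (Phi u : ℂ) * Complex.exp (w * u) = ∑' n, (phiTerm n u : ℂ) * Complex.exp (w * u) := by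
  rw [tsum_mul_right, ← Complex.ofReal_tsum]
  rfl

theorem integrable_Phi_mul_cexp_of_one_lt {w : ℂ} (hw : 1 < w.re) :
    Integrable fun u : ℝ => (Phi u : ℂ) * Complex.exp (w * u) := by
  have hm : AEStronglyMeasurable (fun u : ℝ => (Phi u : ℂ) * Complex.exp (w * u)) volume := by
    have := continuous_Phi
    exact Continuous.aestronglyMeasurable (by fun_prop)
  simp only [Phi_mul_cexp_eq_tsum] at hm ⊢
  exact integrable_tsum_of_summable_integral_norm (fun n => integrable_phiTerm_mul_cexp n hw)
    (summable_integral_norm_phiTerm hw) hm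

/-- The Laplace transform of `Phi` in terms of the zeta function. -/
theorem integral_Phi_mul_cexp {w : ℂ} (hw : 1 < w.re) :
    ∫ u : ℝ, (Phi u : ℂ) * Complex.exp (w * u)
      = (w - 1) / 8 * (π : ℂ) ^ (-(1 + w) / 4) * Complex.Gamma ((5 + w) / 4)
        * riemannZeta ((1 + w) / 2) := by
  have h := integral_tsum_of_summable_integral_norm
    (fun n => integrable_phiTerm_mul_cexp n hw) (summable_integral_norm_phiTerm hw)
  simp only [← Phi_mul_cexp_eq_tsum] at h
  have hre : 1 < ((1 + w) / 2).re := by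
    rw [show (1 + w) / 2 = (1 + w) / (2 : ℝ) by norm_num, Complex.div_ofReal_re, Complex.add_re,
      Complex.one_re]
    linarith
  rw [← h, zeta_eq_tsum_one_div_nat_add_one_cpow hre, ← tsum_mul_left]
  exact tsum_congr fun n => integral_phiTerm_mul_cexp n hw

/-- The transform converges at the real point $|a|+2>1$, which controls growth to the right;
evenness of $\Phi$ gives the left side. -/
theorem integrable_Phi_mul_exp (a : ℝ) : Integrable fun u : ℝ => |Phi u| * Real.exp (a * |u|) := by
  have hb : 1 < (((|a| + 2 : ℝ)) : ℂ).re := by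
    have := abs_nonneg a
    simp only [Complex.ofReal_re]
    linarith
  have h1 := (integrable_Phi_mul_cexp_of_one_lt hb).norm
  have h2 := h1.comp_neg
  have hc := continuous_Phi
  refine (h1.add h2).mono' (Continuous.aestronglyMeasurable (by fun_prop))
    (Eventually.of_forall fun u => ?_)
  have e : ∀ v : ℝ, ‖(Phi v : ℂ) * Complex.exp (((|a| + 2 : ℝ) : ℂ) * v)‖
      = |Phi v| * Real.exp ((|a| + 2) * v) := fun v => by
    rw [norm_mul, Complex.norm_exp, Complex.norm_real, Real.norm_eq_abs]
    simp
  simp only [Pi.add_apply, e]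
  rw [norm_mul, Real.norm_eq_abs, abs_abs, Real.norm_eq_abs, Real.abs_exp, Phi_neg, ← mul_add]
  refine mul_le_mul_of_nonneg_left ?_ (abs_nonneg _)
  have ha := le_abs_self a
  have ha' := abs_nonneg a
  rcases abs_cases u with ⟨hu, hu'⟩ | ⟨hu, hu'⟩
  · have : Real.exp (a * |u|) ≤ Real.exp ((|a| + 2) * u) := Real.exp_le_exp.2 (by rw [hu]; nlinarith)
    have := Real.exp_pos ((|a| + 2) * -u)
    linarith
  · have : Real.exp (a * |u|) ≤ Real.exp ((|a| + 2) * -u) :=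
      Real.exp_le_exp.2 (by rw [hu]; nlinarith)
    have := Real.exp_pos ((|a| + 2) * u)
    linarith

/-! ### Laplace transforms and Gaussian averaging. -/

/-- A continuous function all of whose two-sided exponential moments are finite. -/
def HasExpMoments (f : ℝ → ℂ) : Prop :=
  Continuous f ∧ ∀ a : ℝ, Integrable fun u : ℝ => ‖f u‖ * Real.exp (a * |u|)

/-- The two-sided Laplace transform (with positive sign in the exponent). -/
def laplace (f : ℝ → ℂ) (w : ℂ) : ℂ := ∫ u : ℝ, f u * Complex.exp (w * u)

theorem norm_mul_cexp_le (c w : ℂ) (u : ℝ) {a : ℝ} (ha : |w.re| ≤ a) :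
    ‖c * Complex.exp (w * u)‖ ≤ ‖c‖ * Real.exp (a * |u|) := by
  rw [norm_mul, Complex.norm_exp]
  refine mul_le_mul_of_nonneg_left (Real.exp_le_exp.2 ?_) (norm_nonneg _)
  rw [Complex.re_mul_ofReal]
  calc w.re * u ≤ |w.re * u| := le_abs_self _
    _ = |w.re| * |u| := abs_mul _ _
    _ ≤ a * |u| := by gcongr

theorem HasExpMoments.integrable {f : ℝ → ℂ} (hf : HasExpMoments f) (w : ℂ) :
    Integrable fun u : ℝ => f u * Complex.exp (w * u) := by
  have := hf.1
  exact (hf.2 |w.re|).mono' (Continuous.aestronglyMeasurable (by fun_prop))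
    (Eventually.of_forall fun u => norm_mul_cexp_le _ _ _ le_rfl)

theorem HasExpMoments.ofReal_mul {f : ℝ → ℂ} (hf : HasExpMoments f) :
    HasExpMoments fun u => (u : ℂ) * f u := by
  have hc := hf.1
  refine ⟨by fun_prop, fun a => (hf.2 (a + 1)).mono'
    (Continuous.aestronglyMeasurable (by fun_prop)) (Eventually.of_forall fun u => ?_)⟩
  rw [norm_mul, norm_norm, norm_mul, Complex.norm_real, Real.norm_eq_abs, Real.norm_eq_abs,
    Real.abs_exp, add_mul, Real.exp_add, one_mul]
  have h1 : |u| ≤ Real.exp |u| := by linarith [Real.add_one_le_exp |u|]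
  calc |u| * ‖f u‖ * Real.exp (a * |u|) = ‖f u‖ * Real.exp (a * |u|) * |u| := by ring
    _ ≤ ‖f u‖ * Real.exp (a * |u|) * Real.exp |u| := by gcongr
    _ = _ := by ring

theorem HasExpMoments.gaussian_mul {f : ℝ → ℂ} (hf : HasExpMoments f) {T : ℝ} (hT : 0 ≤ T) :
    HasExpMoments fun u => (Real.exp (-T * u ^ 2) : ℝ) * f u := by
  have hc := hf.1
  refine ⟨by fun_prop, fun a => (hf.2 a).mono'
    (Continuous.aestronglyMeasurable (by fun_prop)) (Eventually.of_forall fun u => ?_)⟩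
  rw [norm_mul, norm_norm, norm_mul, Complex.norm_real, Real.norm_eq_abs, Real.norm_eq_abs,
    Real.abs_exp, Real.abs_exp]
  have : Real.exp (-T * u ^ 2) ≤ 1 := Real.exp_le_one_iff.2 (by nlinarith [sq_nonneg u])
  have h0 : 0 ≤ ‖f u‖ * Real.exp (a * |u|) := by positivity
  nlinarith

theorem HasExpMoments.hasDerivAt_laplace {f : ℝ → ℂ} (hf : HasExpMoments f) (w : ℂ) :
    HasDerivAt (laplace f) (laplace (fun u => (u : ℂ) * f u) w) w := by
  have hc := hf.1
  have h := hasDerivAt_integral_of_dominated_loc_of_deriv_le (μ := volume) (𝕜 := ℂ)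
    (F := fun (w : ℂ) (u : ℝ) => f u * Complex.exp (w * u))
    (F' := fun w u => (u : ℂ) * f u * Complex.exp (w * u)) (x₀ := w)
    (bound := fun u : ℝ => ‖(u : ℂ) * f u‖ * Real.exp ((|w.re| + 1) * |u|))
    (Metric.ball_mem_nhds w one_pos)
    (Eventually.of_forall fun v => (hf.integrable v).1) (hf.integrable w)
    (hf.ofReal_mul.integrable w).1
    (Eventually.of_forall fun u v hv => norm_mul_cexp_le _ _ _ ?_)
    (hf.ofReal_mul.2 _) (Eventually.of_forall fun u v hv => ?_)
  · exact h.2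
  · have h1 : |(v - w).re| ≤ 1 := (Complex.abs_re_le_norm _).trans (by
      rw [← dist_eq_norm]; exact (Metric.mem_ball.1 hv).le)
    calc |v.re| = |w.re + (v - w).re| := by simp
      _ ≤ |w.re| + |(v - w).re| := abs_add_le _ _
      _ ≤ |w.re| + 1 := by gcongr
  · have h1 : HasDerivAt (fun v : ℂ => v * (u : ℂ)) (u : ℂ) v := by
      simpa using (hasDerivAt_id v).mul_const (u : ℂ)
    convert! h1.cexp.const_mul (f u) using 1
    ring

theorem HasExpMoments.differentiable_laplace {f : ℝ → ℂ} (hf : HasExpMoments f) :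
    Differentiable ℂ (laplace f) := fun w => (hf.hasDerivAt_laplace w).differentiableAt

theorem HasExpMoments.deriv_laplace {f : ℝ → ℂ} (hf : HasExpMoments f) :
    deriv (laplace f) = laplace fun u => (u : ℂ) * f u :=
  funext fun w => (hf.hasDerivAt_laplace w).deriv

theorem integrable_cexp_neg_sq_add_mul (c : ℂ) :
    Integrable fun r : ℝ => Complex.exp (-(r : ℂ) ^ 2 + c * r) := by
  simpa using integrable_cexp_quadratic' (b := -1) (by simp) c 0

theorem integral_cexp_neg_sq_add_mul (c : ℂ) :
    ∫ r : ℝ, Complex.exp (-(r : ℂ) ^ 2 + c * r) = (√π : ℝ) * Complex.exp (c ^ 2 / 4) := by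
  have h := integral_cexp_quadratic (b := -1) (by simp) c 0
  have e : ((π : ℂ) / - -1) ^ (1 / 2 : ℂ) = ((√π : ℝ) : ℂ) := by
    rw [Real.sqrt_eq_rpow, Complex.ofReal_cpow pi_pos.le]
    norm_num
  rw [e] at h
  simp only [add_zero, neg_mul, one_mul, mul_neg, mul_one, zero_sub] at h
  rw [h]
  congr 2
  ring

/-- Multiplication by a Gaussian averages the Laplace transform along a vertical line, whose
abscissa may be moved at will by the choice of `l`. -/
theorem HasExpMoments.laplace_gaussian_mul {f : ℝ → ℂ} (hf : HasExpMoments f) (σ : ℝ) (l w : ℂ) :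
    laplace (fun u => (Real.exp (-σ ^ 2 * u ^ 2) : ℝ) * f u) w
      = Complex.exp (σ ^ 2 * l ^ 2) / (√π : ℝ) *
        ∫ r : ℝ, Complex.exp (-(r : ℂ) ^ 2 + (-2 * Complex.I * σ * l) * r) *
          laplace f (w - 2 * σ ^ 2 * l + 2 * Complex.I * σ * r) := by
  have hc := hf.1
  have hsq : ((√π : ℝ) : ℂ) ≠ 0 := Complex.ofReal_ne_zero.2 (by positivity)
  set w' := w - 2 * σ ^ 2 * l with hw'
  set c := -2 * Complex.I * σ * l with hcdef
  have hint : Integrable (Function.uncurry fun (r u : ℝ) =>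
      Complex.exp (-(r : ℂ) ^ 2 + c * r) * (f u * Complex.exp ((w' + 2 * Complex.I * σ * r) * u)))
      (volume.prod volume) := by
    -- The shift $2i\sigma r$ is imaginary, so the modulus of the integrand is a product of a
    -- function of $r$ and one of $u$, and Fubini applies.
    refine ((integrable_cexp_neg_sq_add_mul c).mul_prod (hf.integrable w')).mono
      (Continuous.aestronglyMeasurable (by unfold Function.uncurry; fun_prop))
      (Eventually.of_forall fun p => le_of_eq ?_)
    rcases p with ⟨r, u⟩
    simp only [Function.uncurry_apply_pair, norm_mul, Complex.norm_exp]
    congr 3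
    simp
  have hswap := integral_integral_swap hint
  have e1 : (∫ r : ℝ, Complex.exp (-(r : ℂ) ^ 2 + c * r) *
          laplace f (w' + 2 * Complex.I * σ * r))
      = ∫ r : ℝ, ∫ u : ℝ, Complex.exp (-(r : ℂ) ^ 2 + c * r) *
        (f u * Complex.exp ((w' + 2 * Complex.I * σ * r) * u)) := by
    simp only [laplace, integral_const_mul]
  rw [e1, hswap, laplace, ← integral_const_mul]
  refine integral_congr_ae (Eventually.of_forall fun u => ?_)
  have e2 : ∀ r : ℝ, Complex.exp (-(r : ℂ) ^ 2 + c * r) *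
        (f u * Complex.exp ((w' + 2 * Complex.I * σ * r) * u))
      = f u * Complex.exp (w' * u) *
        Complex.exp (-(r : ℂ) ^ 2 + (2 * Complex.I * σ * (u - l)) * r) := fun r => by
    rw [mul_left_comm, mul_assoc (f u), ← Complex.exp_add, ← Complex.exp_add]
    congr 2
    rw [hcdef]
    ring
  simp only [e2]
  rw [integral_const_mul, integral_cexp_neg_sq_add_mul]
  rw [show Complex.exp (σ ^ 2 * l ^ 2) / (√π : ℝ) * (f u * Complex.exp (w' * u) *
      ((√π : ℝ) * Complex.exp ((2 * Complex.I * σ * (u - l)) ^ 2 / 4)))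
      = f u * (Complex.exp (σ ^ 2 * l ^ 2) * Complex.exp (w' * u) *
        Complex.exp ((2 * Complex.I * σ * (u - l)) ^ 2 / 4)) by field_simp,
    ← Complex.exp_add, ← Complex.exp_add, mul_comm _ (f u), mul_assoc (f u), Complex.ofReal_exp,
    ← Complex.exp_add]
  congr 2
  rw [hw']
  push_cast
  linear_combination (-(σ : ℂ) ^ 2 * (u - l) ^ 2) * Complex.I_sq

/-! ### The function `xiLaplace` and the averaging formulas for $H_t$ and $H_t'$. -/

theorem hasExpMoments_Phi : HasExpMoments fun u => (Phi u : ℂ) := by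
  have := continuous_Phi
  refine ⟨by fun_prop, fun a => ?_⟩
  simpa using integrable_Phi_mul_exp a

/-- The function `w ↦ ∫ Φ(u) e^{wu} du = 2 H_0(-iw)`. -/
def xiLaplace (w : ℂ) : ℂ := laplace (fun u => (Phi u : ℂ)) w

theorem xiLaplace_eq {w : ℂ} (hw : 1 < w.re) :
    xiLaplace w = (w - 1) / 8 * (π : ℂ) ^ (-(1 + w) / 4) * Complex.Gamma ((5 + w) / 4)
        * riemannZeta ((1 + w) / 2) := integral_Phi_mul_cexp hw

theorem differentiable_xiLaplace : Differentiable ℂ xiLaplace :=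
  hasExpMoments_Phi.differentiable_laplace

theorem xiLaplace_neg (w : ℂ) : xiLaplace (-w) = xiLaplace w := by
  rw [xiLaplace, laplace, ← integral_neg_eq_self]
  simp [Phi_neg, xiLaplace, laplace]

theorem H_eq_laplace (t : ℝ) (ht : t ≤ 0) (z : ℂ) :
    H t z = 1 / 2 * laplace (fun u => (Real.exp (t * u ^ 2) : ℝ) * (Phi u : ℂ))
      (Complex.I * z) := by
  have hm := hasExpMoments_Phi.gaussian_mul (T := -t) (by linarith)
  rw [neg_neg] at hm
  set f : ℝ → ℂ := fun u => (Real.exp (t * u ^ 2) : ℝ) * (Phi u : ℂ) with hf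
  have hfn : ∀ u, f (-u) = f u := fun u => by simp [hf, Phi_neg]
  have i1 := hm.integrable (Complex.I * z)
  have i2 := i1.comp_neg
  rw [laplace, ← integral_add_compl (s := Ioi 0) measurableSet_Ioi i1, compl_Ioi,
    ← neg_zero, ← integral_comp_neg_Ioi, neg_zero, ← integral_add i1.integrableOn i2.integrableOn,
    ← integral_const_mul, H]
  refine setIntegral_congr_fun measurableSet_Ioi fun u _ => ?_
  simp only [hf, Phi_neg]
  rw [Complex.cos]
  push_cast
  ring_nf

theorem hasDerivAt_H (t : ℝ) (ht : t ≤ 0) (z : ℂ) :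
    HasDerivAt (H t) (Complex.I / 2 * laplace (fun u => (Real.exp (t * u ^ 2) : ℝ) *
      ((u : ℂ) * (Phi u : ℂ))) (Complex.I * z)) z := by
  have hm := hasExpMoments_Phi.gaussian_mul (T := -t) (by linarith)
  rw [neg_neg] at hm
  rw [funext (H_eq_laplace t ht)]
  have h1 : HasDerivAt (fun z => Complex.I * z) Complex.I z := by
    simpa using (hasDerivAt_id z).const_mul Complex.I
  convert! ((hm.hasDerivAt_laplace (Complex.I * z)).comp z h1).const_mul (1 / 2 : ℂ) using 1
  simp only [mul_left_comm]
  ring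

theorem H_eq_gaussian_average (σ : ℝ) (l z : ℂ) :
    H (-σ ^ 2) z = 1 / 2 * (Complex.exp (σ ^ 2 * l ^ 2) / (√π : ℝ) *
        ∫ r : ℝ, Complex.exp (-(r : ℂ) ^ 2 + (-2 * Complex.I * σ * l) * r) *
          xiLaplace (Complex.I * z - 2 * σ ^ 2 * l + 2 * Complex.I * σ * r)) := by
  rw [H_eq_laplace _ (by nlinarith [sq_nonneg σ]), hasExpMoments_Phi.laplace_gaussian_mul σ l]
  rfl

theorem deriv_H_eq_gaussian_average (σ : ℝ) (l z : ℂ) :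
    deriv (H (-σ ^ 2)) z = Complex.I / 2 * (Complex.exp (σ ^ 2 * l ^ 2) / (√π : ℝ) *
        ∫ r : ℝ, Complex.exp (-(r : ℂ) ^ 2 + (-2 * Complex.I * σ * l) * r) *
          deriv xiLaplace (Complex.I * z - 2 * σ ^ 2 * l + 2 * Complex.I * σ * r)) := by
  rw [(hasDerivAt_H _ (by nlinarith [sq_nonneg σ]) z).deriv,
    hasExpMoments_Phi.ofReal_mul.laplace_gaussian_mul σ l]
  simp only [← hasExpMoments_Phi.deriv_laplace]
  rfl

/-! ### Stirling's formula with remainder in the right half-plane. -/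

/-- The summand of Gudermann's series for the remainder in Stirling's formula. -/
def gudermannTerm (v : ℂ) : ℂ := (v + 1 / 2) * (Complex.log (v + 1) - Complex.log v) - 1

/-- The remainder in Stirling's formula, as Gudermann's series. -/
def stirlingRemainder (v : ℂ) : ℂ := ∑' k : ℕ, gudermannTerm (v + k)

theorem norm_le_norm_add_ofReal {v : ℂ} (hv : 0 < v.re) {x : ℝ} (hx : 0 ≤ x) :
    ‖v‖ ≤ ‖v + x‖ := by
  rw [Complex.norm_def, Complex.norm_def]
  refine Real.sqrt_le_sqrt ?_
  simp only [Complex.normSq_apply, Complex.add_re, Complex.ofReal_re, Complex.add_im,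
    Complex.ofReal_im]
  nlinarith

/-- As $\Re v>0$ and $x\ge0$, $\|v+x\|^2\ge\|v\|^2+x^2\ge\frac12(\|v\|+x)^2$. -/
theorem norm_add_ofReal_le {v : ℂ} (hv : 0 < v.re) {x : ℝ} (hx : 0 ≤ x) :
    (‖v‖ + x) ^ 2 ≤ 2 * ‖v + x‖ ^ 2 := by
  rw [← Complex.normSq_eq_norm_sq]
  have h := Complex.normSq_eq_norm_sq v
  simp only [Complex.normSq_apply, Complex.add_re, Complex.ofReal_re, Complex.add_im,
    Complex.ofReal_im] at h ⊢
  nlinarith [sq_nonneg (‖v‖ - x), mul_nonneg hv.le hx]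

theorem norm_gudermannTerm_le {v : ℂ} (hv : 0 < v.re) :
    ‖gudermannTerm v‖ ≤ 1 / (4 * ‖v‖ ^ 2) := by
  have hre : ∀ x : ℝ, 0 ≤ x → 0 < (v + x).re := fun x hx => by simp; linarith
  have hne : ∀ x : ℝ, 0 ≤ x → v + x ≠ 0 := fun x hx h => by
    have := hre x hx
    rw [h] at this
    simp at this
  have hv0 : 0 < ‖v‖ := by
    have := hne 0 le_rfl
    simpa using this
  have hh : v + 1 / 2 ≠ 0 := by simpa using hne (1 / 2) (by norm_num)
  -- The increment of `q` over $[0,1]$ is the Gudermann term. The quadratic vanishes at both ends,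
  -- so it does not affect the increment, and it makes the derivative quadratic in $\frac12-x$ and
  -- of order $\|v\|^{-2}$.
  set q : ℝ → ℂ := fun x => (v + 1 / 2) * Complex.log (v + x) - x
    - (x - x ^ 2) / 2 / (v + 1 / 2) with hq
  have hd : ∀ x ∈ Icc (0 : ℝ) 1, HasDerivWithinAt q
      ((1 / 2 - x) ^ 2 / ((v + x) * (v + 1 / 2))) (Icc (0 : ℝ) 1) x := fun x hx => by
    have h0 : HasDerivAt (fun x : ℝ => (x : ℂ)) 1 x := Complex.ofRealCLM.hasDerivAt
    have h1 : HasDerivAt (fun x : ℝ => v + (x : ℂ)) 1 x := h0.const_add v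
    have h2 : HasDerivAt (fun x : ℝ => Complex.log (v + (x : ℂ))) (1 / (v + x)) x :=
      h1.clog_real (Or.inl (hre x hx.1))
    have h3 := ((h2.const_mul (v + 1 / 2)).sub h0).sub
      (((h0.sub (h0.pow 2)).div_const 2).div_const (v + 1 / 2))
    refine (HasDerivAt.hasDerivWithinAt ?_)
    convert! h3 using 1
    have := hne x hx.1
    have hh2 : 2 * v + 1 ≠ 0 := fun h => hh (by linear_combination h / 2)
    have e : v + 1 / 2 = (2 * v + 1) / 2 := by ring
    rw [e]
    push_cast
    field_simp
    ring
  have hb : ∀ x ∈ Ico (0 : ℝ) 1, ‖((1 / 2 - x) ^ 2 / ((v + x) * (v + 1 / 2)) : ℂ)‖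
      ≤ 1 / (4 * ‖v‖ ^ 2) := fun x hx => by
    have e : ‖((1 / 2 - x) ^ 2 : ℂ)‖ ≤ 1 / 4 := by
      rw [show ((1 / 2 - x) ^ 2 : ℂ) = (((1 / 2 - x) ^ 2 : ℝ) : ℂ) by push_cast; rfl,
        Complex.norm_real, Real.norm_of_nonneg (sq_nonneg _)]
      nlinarith [hx.1, hx.2]
    have n1 := norm_le_norm_add_ofReal hv hx.1
    have n2 := norm_le_norm_add_ofReal hv (x := 1 / 2) (by norm_num)
    push_cast at n2
    rw [norm_div, norm_mul]
    calc _ ≤ (1 / 4) / (‖v‖ * ‖v‖) := by gcongr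
      _ = _ := by field_simp
  have h := norm_image_sub_le_of_norm_deriv_le_segment_01' hd hb
  have e : q 1 - q 0 = gudermannTerm v := by
    simp only [hq, gudermannTerm, Complex.ofReal_one, Complex.ofReal_zero]
    ring_nf
  rwa [e] at h

/-- Telescoping comparison with $1/(R+k)-1/(R+k+1)$, at the cost of the factor
$(R+k+1)/(R+k)\le1+1/R$. -/
theorem sum_one_div_sq_le {R : ℝ} (hR : 0 < R) (n : ℕ) :
    ∑ k ∈ Finset.range n, 1 / (2 * (R + k) ^ 2) ≤ (1 + 1 / R) / (2 * R) := by
  have h : ∑ k ∈ Finset.range n, 1 / (2 * (R + k) ^ 2)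
      ≤ (1 + 1 / R) / 2 * (1 / R - 1 / (R + n)) := by
    induction n with
    | zero => simp
    | succ n ih =>
      rw [Finset.sum_range_succ]
      have hp : 0 < R + n := by positivity
      have : 1 / (2 * (R + n) ^ 2) ≤ (1 + 1 / R) / 2 * (1 / (R + n) - 1 / (R + (n + 1 : ℕ))) := by
        push_cast
        rw [div_sub_div _ _ hp.ne' (by positivity), one_add_div hR.ne', div_div, div_mul_div_comm,
          div_le_div_iff₀ (by positivity) (by positivity)]
        have hn : (0 : ℝ) ≤ n := n.cast_nonneg
        nlinarith [mul_nonneg hR.le hn, mul_nonneg (mul_nonneg hR.le hn) hn,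
          mul_nonneg (mul_nonneg hR.le hR.le) hn, mul_nonneg hn hn]
      linarith
  refine h.trans ?_
  have : 0 ≤ 1 / (R + n) := by positivity
  have h2 : (1 + 1 / R) / (2 * R) = (1 + 1 / R) / 2 * (1 / R) := by field_simp
  rw [h2]
  gcongr
  linarith

theorem norm_gudermannTerm_add_natCast_le {v : ℂ} (hv : 0 < v.re) {R : ℝ} (hR : 0 < R)
    (hRv : R ≤ ‖v‖) (k : ℕ) : ‖gudermannTerm (v + k)‖ ≤ 1 / (2 * (R + k) ^ 2) := by
  have h1 := norm_gudermannTerm_le (v := v + k) (by simp; positivity)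
  have h2 := norm_add_ofReal_le hv (x := k) (by positivity)
  push_cast at h2
  refine h1.trans ?_
  gcongr 1 / ?_
  have : (R + k) ^ 2 ≤ (‖v‖ + k) ^ 2 := by gcongr
  linarith

theorem norm_stirlingRemainder_le {v : ℂ} (hv : 0 < v.re) (hv' : 1 / 2 ≤ ‖v‖) :
    ‖stirlingRemainder v‖ ≤ 3 / (2 * ‖v‖) := by
  have hR : 0 < ‖v‖ := by linarith
  have h := summable_of_sum_range_le (f := fun k : ℕ => 1 / (2 * (‖v‖ + k) ^ 2))
    (fun k => by positivity) (sum_one_div_sq_le hR)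
  refine (tsum_of_norm_bounded h.hasSum
    (norm_gudermannTerm_add_natCast_le hv hR le_rfl)).trans ?_
  refine (Real.tsum_le_of_sum_range_le (fun k => by positivity) (sum_one_div_sq_le hR)).trans ?_
  gcongr
  have : 1 / ‖v‖ ≤ 2 := by rw [div_le_iff₀ hR]; linarith
  linarith

theorem summable_gudermannTerm {v : ℂ} (hv : 0 < v.re) :
    Summable fun k : ℕ => gudermannTerm (v + k) := by
  have hR : 0 < ‖v‖ := norm_pos_iff.2 fun h => by rw [h] at hv; simp at hv
  exact Summable.of_norm_bounded (summable_of_sum_range_le (fun k => by positivity)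
    (sum_one_div_sq_le hR)) (norm_gudermannTerm_add_natCast_le hv hR le_rfl)

theorem differentiableOn_stirlingRemainder :
    DifferentiableOn ℂ stirlingRemainder {v | 1 / 2 < v.re} := by
  have hR : (0 : ℝ) < 1 / 2 := by norm_num
  refine Complex.differentiableOn_tsum_of_summable_norm (summable_of_sum_range_le
    (fun k => by positivity) (sum_one_div_sq_le hR)) (fun k v hv => ?_)
    (isOpen_lt continuous_const Complex.continuous_re) fun k v hv => ?_
  · have hv' : 1 / 2 < v.re := hv
    have hk : (0 : ℝ) ≤ k := k.cast_nonneg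
    unfold gudermannTerm
    have s1 : v + k + 1 ∈ Complex.slitPlane := Or.inl (by simp; linarith)
    have s2 : v + k ∈ Complex.slitPlane := Or.inl (by simp; linarith)
    have d1 : DifferentiableAt ℂ (fun v : ℂ => Complex.log (v + k + 1)) v :=
      DifferentiableAt.clog (by fun_prop) s1
    have d2 : DifferentiableAt ℂ (fun v : ℂ => Complex.log (v + k)) v :=
      DifferentiableAt.clog (by fun_prop) s2
    exact DifferentiableAt.differentiableWithinAt (by fun_prop)
  · have hv' : 1 / 2 < v.re := hv
    exact norm_gudermannTerm_add_natCast_le (by linarith) hR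
      (hv'.le.trans (Complex.re_le_norm v)) k

/-- Cauchy's estimate on the circle of radius $1/4$, where the remainder is at most $2/\|v\|$. -/
theorem norm_deriv_stirlingRemainder_le {v : ℂ} (hv : 1 ≤ v.re) :
    ‖deriv stirlingRemainder v‖ ≤ 8 / ‖v‖ := by
  have hn : 1 ≤ ‖v‖ := hv.trans (Complex.re_le_norm v)
  have hball : ∀ u ∈ Metric.closedBall v (1 / 4), 3 / 4 ≤ u.re ∧ 3 / 4 * ‖v‖ ≤ ‖u‖ :=
    fun u hu => by
      have hd : ‖u - v‖ ≤ 1 / 4 := by rw [← dist_eq_norm]; exact hu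
      have h1 := (abs_le.1 ((Complex.abs_re_le_norm (u - v)).trans hd)).1
      rw [Complex.sub_re] at h1
      have h2 := norm_sub_norm_le v u
      rw [norm_sub_rev] at h2
      constructor <;> linarith
  have hd : DiffContOnCl ℂ stirlingRemainder (Metric.ball v (1 / 4)) := by
    refine DifferentiableOn.diffContOnCl ?_
    rw [closure_ball _ (by norm_num)]
    refine differentiableOn_stirlingRemainder.mono fun u hu => ?_
    have := (hball u hu).1
    show 1 / 2 < u.re
    linarith
  have h := Complex.norm_deriv_le_of_forall_mem_sphere_norm_le (C := 2 / ‖v‖) (by norm_num) hd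
    fun u hu => by
      obtain ⟨h1, h2⟩ := hball u (Metric.sphere_subset_closedBall hu)
      refine (norm_stirlingRemainder_le (by linarith) (by linarith)).trans ?_
      calc 3 / (2 * ‖u‖) ≤ 3 / (2 * (3 / 4 * ‖v‖)) := by gcongr
        _ = 2 / ‖v‖ := by field_simp; norm_num
  refine h.trans (le_of_eq ?_)
  field_simp
  norm_num

/-- Summation by parts; this is what makes the series compute $\prod(v+k)$. -/
theorem sum_gudermannTerm (v : ℂ) (m : ℕ) :
    ∑ k ∈ Finset.range m, gudermannTerm (v + k)
      = (v + m - 1 / 2) * Complex.log (v + m) - (v - 1 / 2) * Complex.log v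
        - ∑ k ∈ Finset.range m, Complex.log (v + k) - m := by
  induction m with
  | zero => simp
  | succ m ih =>
    rw [Finset.sum_range_succ, Finset.sum_range_succ, ih, gudermannTerm]
    push_cast
    rw [← add_assoc]
    ring

theorem prod_add_natCast_eq_exp {v : ℂ} (hv : 0 < v.re) (m : ℕ) :
    ∏ k ∈ Finset.range m, (v + k) = Complex.exp ((v + m - 1 / 2) * Complex.log (v + m)
      - (v - 1 / 2) * Complex.log v - m - ∑ k ∈ Finset.range m, gudermannTerm (v + k)) := by
  rw [sum_gudermannTerm]
  have : ∏ k ∈ Finset.range m, (v + k) = ∏ k ∈ Finset.range m, Complex.exp (Complex.log (v + k)) :=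
    Finset.prod_congr rfl fun k _ => (Complex.exp_log fun h => by
      have : 0 < (v + k).re := by simp; positivity
      rw [h] at this
      simp at this).symm
  rw [this, ← Complex.exp_sum]
  congr 1
  ring

/-- Writing $n!$ through `Stirling.stirlingSeq` cancels all growing terms against those of the
product. Each remaining piece has a limit, and $\sqrt{2\pi}$ comes from the known limit $\sqrt\pi$
of `Stirling.stirlingSeq`. -/
theorem GammaSeq_eq_exp {v : ℂ} (hv : 0 < v.re) {n : ℕ} (hn : n ≠ 0) :
    Complex.GammaSeq v n = (Stirling.stirlingSeq n * √2 : ℝ) *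
      Complex.exp ((v - 1 / 2) * Complex.log v
        + ∑ k ∈ Finset.range (n + 1), gudermannTerm (v + k) + 1
        - (n * Complex.log (1 + (v + 1) / n) + (v + 1 / 2) * Complex.log (1 + (v + 1) / n))) := by
  have hn0 : (0 : ℝ) < n := by positivity
  have hnc : (n : ℂ) ≠ 0 := by exact_mod_cast hn0.ne'
  have hne : 1 + (v + 1) / n ≠ 0 := fun h => by
    have : 0 < (1 + (v + 1) / n).re := by
      rw [Complex.add_re, show ((n : ℂ)) = ((n : ℝ) : ℂ) by push_cast; rfl, Complex.div_ofReal_re]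
      simp only [Complex.add_re, Complex.one_re]
      positivity
    rw [h] at this
    simp at this
  have hlog : Complex.log (v + (n + 1 : ℕ)) = Complex.log n + Complex.log (1 + (v + 1) / n) := by
    have := Complex.log_ofReal_mul hn0 hne
    rw [Complex.ofReal_natCast] at this
    rw [Complex.natCast_log] at this
    rw [← this]
    congr 1
    push_cast
    field_simp
    ring
  have hfac : ((n.factorial : ℝ) : ℂ) = (Stirling.stirlingSeq n * √2 : ℝ) *
      Complex.exp (1 / 2 * Complex.log n + n * Complex.log n - n) := by
    rw [← Complex.natCast_log]
    rw [show (1 / 2 * ((Real.log n : ℝ) : ℂ) + n * ((Real.log n : ℝ) : ℂ) - n)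
      = ((1 / 2 * Real.log n + n * Real.log n - n : ℝ) : ℂ) by push_cast; ring,
      ← Complex.ofReal_exp, ← Complex.ofReal_mul]
    congr 1
    rw [Stirling.stirlingSeq, Real.sqrt_mul (by norm_num), Real.exp_sub, Real.exp_add,
      show 1 / 2 * Real.log n = Real.log n * (1 / 2) by ring, Real.exp_mul, Real.exp_log hn0,
      ← Real.sqrt_eq_rpow, Real.exp_nat_mul, Real.exp_log hn0, div_pow, ← Real.exp_nat_mul, mul_one]
    have : 0 < √(n : ℝ) := by positivity
    field_simp
  rw [Complex.GammaSeq, prod_add_natCast_eq_exp hv, hlog, Complex.cpow_def_of_ne_zero hnc,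
    ← Complex.ofReal_natCast n.factorial, hfac, mul_left_comm, ← Complex.exp_add, mul_div_assoc,
    ← Complex.exp_sub]
  congr 2
  push_cast
  ring

theorem Gamma_eq_stirling {v : ℂ} (hv : 0 < v.re) :
    Complex.Gamma v = (√(2 * π) : ℝ) *
      Complex.exp ((v - 1 / 2) * Complex.log v - v + stirlingRemainder v) := by
  have h1 : Tendsto (fun n : ℕ => (n : ℂ) * Complex.log (1 + (v + 1) / n)) atTop (𝓝 (v + 1)) := by
    refine Complex.tendsto_nat_mul_log_one_add_of_tendsto (g := fun n : ℕ => (v + 1) / n) ?_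
    refine tendsto_const_nhds.congr' ?_
    filter_upwards [eventually_ne_atTop 0] with n hn
    have : (n : ℂ) ≠ 0 := by exact_mod_cast hn
    field_simp
  have h2 : Tendsto (fun n : ℕ => (v + 1 / 2) * Complex.log (1 + (v + 1) / n)) atTop (𝓝 0) := by
    have : Tendsto (fun n : ℕ => (v + 1) / (n : ℂ)) atTop (𝓝 0) :=
      tendsto_const_div_atTop_nhds_zero_nat _
    have h := ((this.const_add 1).clog (by simp)).const_mul (v + 1 / 2)
    simpa using h
  have h3 : Tendsto (fun n : ℕ => ∑ k ∈ Finset.range (n + 1), gudermannTerm (v + k)) atTop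
      (𝓝 (stirlingRemainder v)) :=
    (tendsto_add_atTop_iff_nat 1).2 (summable_gudermannTerm hv).hasSum.tendsto_sum_nat
  have h4 : Tendsto (fun n : ℕ => ((Stirling.stirlingSeq n * √2 : ℝ) : ℂ)) atTop
      (𝓝 ((√π * √2 : ℝ) : ℂ)) :=
    (Complex.continuous_ofReal.tendsto _).comp
      (Stirling.tendsto_stirlingSeq_sqrt_pi.mul_const _)
  have h5 := h4.mul (((((h3.const_add ((v - 1 / 2) * Complex.log v)).add_const 1).sub
    (h1.add h2))).cexp)
  have h6 : Tendsto (Complex.GammaSeq v) atTop (𝓝 (((√π * √2 : ℝ) : ℂ) * Complex.exp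
      ((v - 1 / 2) * Complex.log v + stirlingRemainder v + 1 - (v + 1 + 0)))) := by
    refine h5.congr' ?_
    filter_upwards [eventually_ne_atTop 0] with n hn
    rw [GammaSeq_eq_exp hv hn]
  rw [tendsto_nhds_unique (Complex.GammaSeq_tendsto_Gamma v) h6, mul_comm 2 π,
    Real.sqrt_mul pi_pos.le]
  congr 2
  ring

/-! ### Variation of the logarithm, and $\zeta$ far to the right. -/

theorem norm_log_sub_log_le {a b : ℂ} {m : ℝ} (ha : 0 < a.re) (hb : 0 < b.re)
    (h : ∀ p ∈ segment ℝ b a, m ≤ ‖p‖) (hm : 0 < m) :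
    ‖Complex.log a - Complex.log b‖ ≤ ‖a - b‖ / m := by
  have hre : ∀ p ∈ segment ℝ b a, 0 < p.re := fun p hp =>
    (convex_halfSpace_re_gt 0).segment_subset hb ha hp
  have := (convex_segment b a).norm_image_sub_le_of_norm_hasDerivWithin_le (𝕜 := ℂ)
    (f := Complex.log) (f' := fun p => p⁻¹) (C := 1 / m)
    (fun p hp => (Complex.hasDerivAt_log (Or.inl (hre p hp))).hasDerivWithinAt)
    (fun p hp => by rw [norm_inv, ← one_div]; exact one_div_le_one_div_of_le hm (h p hp))
    (left_mem_segment ℝ b a) (right_mem_segment ℝ b a)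
  rwa [one_div_mul_eq_div] at this

theorem norm_log_sub_log_le_of_le_re {a b : ℂ} {m : ℝ} (hm : 0 < m) (ha : m ≤ a.re)
    (hb : m ≤ b.re) : ‖Complex.log a - Complex.log b‖ ≤ ‖a - b‖ / m :=
  norm_log_sub_log_le (hm.trans_le ha) (hm.trans_le hb)
    (fun p hp => ((convex_halfSpace_re_ge m).segment_subset hb ha hp).trans (Complex.re_le_norm p))
    hm

/-- Termwise $(k+2)^{-\Re s}\le2^{2-\Re s}(k+2)^{-2}$, and $\sum_{k\ge0}(k+2)^{-2}\le1$ by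
telescoping. -/
theorem norm_riemannZeta_sub_one_le {s : ℂ} (hs : 2 ≤ s.re) :
    ‖riemannZeta s - 1‖ ≤ (2 : ℝ) ^ (2 - s.re) := by
  have hs1 : 1 < s.re := by linarith
  have hsum : Summable fun n : ℕ => 1 / ((n : ℂ) + 1) ^ s := by
    have := (summable_nat_add_iff 1).2 (Complex.summable_one_div_nat_cpow.2 hs1)
    simpa using this
  rw [zeta_eq_tsum_one_div_nat_add_one_cpow hs1, hsum.tsum_eq_zero_add]
  simp only [Nat.cast_zero, zero_add, Complex.one_cpow, div_one, add_sub_cancel_left]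
  have hpart : ∀ n, ∑ k ∈ Finset.range n, (2 : ℝ) ^ (2 - s.re) * (1 / ((k : ℝ) + 2) ^ 2)
      ≤ (2 : ℝ) ^ (2 - s.re) := fun n => by
    rw [← Finset.mul_sum]
    have : ∑ k ∈ Finset.range n, 1 / ((k : ℝ) + 2) ^ 2 ≤ 1 - 1 / ((n : ℝ) + 1) := by
      induction n with
      | zero => simp
      | succ n ih =>
        rw [Finset.sum_range_succ]
        have : 1 / ((n : ℝ) + 2) ^ 2 ≤ 1 / ((n : ℝ) + 1) - 1 / (((n + 1 : ℕ) : ℝ) + 1) := by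
          push_cast
          rw [div_sub_div _ _ (by positivity) (by positivity),
            div_le_div_iff₀ (by positivity) (by positivity)]
          have hn : (0 : ℝ) ≤ n := n.cast_nonneg
          nlinarith
        linarith
    have h1 : 0 ≤ 1 / ((n : ℝ) + 1) := by positivity
    have h2 : 0 < (2 : ℝ) ^ (2 - s.re) := by positivity
    nlinarith
  have hnn : ∀ k : ℕ, 0 ≤ (2 : ℝ) ^ (2 - s.re) * (1 / ((k : ℝ) + 2) ^ 2) := fun k => by positivity
  refine (tsum_of_norm_bounded (summable_of_sum_range_le hnn hpart).hasSum fun k => ?_).trans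
    (Real.tsum_le_of_sum_range_le hnn hpart)
  have hk : (0 : ℝ) < (k : ℝ) + 2 := by positivity
  have e : ((k + 1 : ℕ) : ℂ) + 1 = (((k : ℝ) + 2 : ℝ) : ℂ) := by push_cast; ring
  rw [e, norm_div, norm_one, Complex.norm_cpow_eq_rpow_re_of_pos hk, one_div, one_div,
    ← Real.rpow_neg hk.le, ← Real.rpow_natCast, ← Real.rpow_neg hk.le]
  have e2 : -s.re = (2 - s.re) + -((2 : ℕ) : ℝ) := by push_cast; ring
  rw [e2, Real.rpow_add hk]
  refine mul_le_mul_of_nonneg_right ?_ (by positivity)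
  exact Real.rpow_le_rpow_of_nonpos (by norm_num) (by linarith) (by linarith)

theorem norm_riemannZeta_sub_one_le_half {s : ℂ} (hs : 3 ≤ s.re) :
    ‖riemannZeta s - 1‖ ≤ 1 / 2 := by
  refine (norm_riemannZeta_sub_one_le (by linarith)).trans ?_
  calc (2 : ℝ) ^ (2 - s.re) ≤ (2 : ℝ) ^ (-1 : ℝ) :=
        Real.rpow_le_rpow_of_exponent_le (by norm_num) (by linarith)
    _ = 1 / 2 := by rw [Real.rpow_neg_one]; norm_num

theorem half_le_norm_riemannZeta {s : ℂ} (hs : 3 ≤ s.re) : 1 / 2 ≤ ‖riemannZeta s‖ := by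
  have h := norm_riemannZeta_sub_one_le_half hs
  have h2 := norm_sub_norm_le 1 (riemannZeta s)
  rw [norm_sub_rev, norm_one] at h2
  linarith

theorem differentiableAt_riemannZeta_of_one_lt {s : ℂ} (hs : 1 < s.re) :
    DifferentiableAt ℂ riemannZeta s :=
  differentiableAt_riemannZeta fun h => by rw [h] at hs; simp at hs

/-- Cauchy's estimate for $\zeta-1$ on the unit circle about $s$. -/
theorem norm_deriv_riemannZeta_le {s : ℂ} (hs : 3 ≤ s.re) :
    ‖deriv riemannZeta s‖ ≤ (2 : ℝ) ^ (3 - s.re) := by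
  have hball : ∀ u ∈ Metric.closedBall s 1, s.re - 1 ≤ u.re := fun u hu => by
    have hd : ‖u - s‖ ≤ 1 := by rw [← dist_eq_norm]; exact hu
    have h1 := (abs_le.1 ((Complex.abs_re_le_norm (u - s)).trans hd)).1
    rw [Complex.sub_re] at h1
    linarith
  have hd : DiffContOnCl ℂ (fun u => riemannZeta u - 1) (Metric.ball s 1) := by
    refine DifferentiableOn.diffContOnCl ?_
    rw [closure_ball _ (by norm_num)]
    intro u hu
    have := hball u hu
    exact ((differentiableAt_riemannZeta_of_one_lt (by linarith)).sub_const 1).differentiableWithinAt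
  have h := Complex.norm_deriv_le_of_forall_mem_sphere_norm_le (C := (2 : ℝ) ^ (3 - s.re))
    one_pos hd fun u hu => by
      have := hball u (Metric.sphere_subset_closedBall hu)
      refine (norm_riemannZeta_sub_one_le (by linarith)).trans ?_
      exact Real.rpow_le_rpow_of_exponent_le (by norm_num) (by linarith)
  rwa [deriv_sub_const, div_one] at h

/-- Source of the decay $e^{-\pi|\Im w|/8}$, used with $\Im s=\Im w/4$. The complementary angle
$\frac\pi2-|\arg s|$ has sine $\Re s/\|s\|$, and Jordan's inequality bounds the angle by $\frac\pi2$
times its sine. -/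
theorem abs_im_mul_arg_sub_le {s : ℂ} (hs : 0 < s.re) :
    |π / 2 * |s.im| - s.im * Complex.arg s| ≤ π / 2 * s.re := by
  have habs : s.im * Complex.arg s = |s.im| * |Complex.arg s| := by
    rcases le_or_gt 0 s.im with h | h
    · rw [abs_of_nonneg h, abs_of_nonneg (Complex.arg_nonneg_iff.2 h)]
    · rw [abs_of_neg h, abs_of_neg (Complex.arg_neg_iff.2 h)]
      ring
  have hlt : |Complex.arg s| < π / 2 := Complex.abs_arg_lt_pi_div_two_iff.2 (Or.inl hs)
  have hn : 0 ≤ ‖s‖ := norm_nonneg s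
  have hre : s.re = ‖s‖ * Real.sin (π / 2 - |Complex.arg s|) := by
    rw [Real.sin_pi_div_two_sub, Real.cos_abs, Complex.norm_mul_cos_arg]
  have hj := Real.mul_le_sin (x := π / 2 - |Complex.arg s|) (by linarith)
    (by linarith [abs_nonneg (Complex.arg s)])
  have him : |s.im| ≤ ‖s‖ := Complex.abs_im_le_norm s
  have hpi := pi_pos
  rw [habs, show π / 2 * |s.im| - |s.im| * |Complex.arg s| = (π / 2 - |Complex.arg s|) * |s.im| by
    ring, abs_of_nonneg]
  · have h1 : π / 2 - |Complex.arg s| ≤ π / 2 * Real.sin (π / 2 - |Complex.arg s|) := by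
      have := mul_le_mul_of_nonneg_left hj (show 0 ≤ π / 2 by positivity)
      rwa [← mul_assoc, show π / 2 * (2 / π) = 1 by field_simp, one_mul] at this
    calc (π / 2 - |Complex.arg s|) * |s.im| ≤ (π / 2 - |Complex.arg s|) * ‖s‖ := by
          refine mul_le_mul_of_nonneg_left him (by linarith)
      _ ≤ (π / 2 * Real.sin (π / 2 - |Complex.arg s|)) * ‖s‖ := by gcongr
      _ = π / 2 * s.re := by rw [hre]; ring
  · exact mul_nonneg (by linarith) (abs_nonneg _)

/-! ### The logarithm of `xiLaplace`: derivative and real part. -/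

/-- A logarithm of `xiLaplace` on the half-plane `7 ≤ re w`. -/
def logXi (w : ℂ) : ℂ :=
  Complex.log (w - 1) - Real.log 8 + -(1 + w) / 4 * Real.log π + Real.log √(2 * π)
    + (((5 + w) / 4 - 1 / 2) * Complex.log ((5 + w) / 4) - (5 + w) / 4
      + stirlingRemainder ((5 + w) / 4)) + Complex.log (riemannZeta ((1 + w) / 2))

theorem re_gamma_and_zeta_arguments (w : ℂ) :
    ((5 + w) / 4).re = (5 + w.re) / 4 ∧ ((5 + w) / 4).im = w.im / 4 ∧
      ((1 + w) / 2).re = (1 + w.re) / 2 := by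
  refine ⟨?_, ?_, ?_⟩
  · rw [show (5 + w) / 4 = (5 + w) / (4 : ℝ) by norm_num, Complex.div_ofReal_re]; simp
  · rw [show (5 + w) / 4 = (5 + w) / (4 : ℝ) by norm_num, Complex.div_ofReal_im]; simp
  · rw [show (1 + w) / 2 = (1 + w) / (2 : ℝ) by norm_num, Complex.div_ofReal_re]; simp

theorem exp_logXi {w : ℂ} (hw : 7 ≤ w.re) : Complex.exp (logXi w) = xiLaplace w := by
  have hz : riemannZeta ((1 + w) / 2) ≠ 0 := riemannZeta_ne_zero_of_one_lt_re (by
    rw [(re_gamma_and_zeta_arguments w).2.2]; linarith)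
  have hw1 : w - 1 ≠ 0 := fun h => by
    have : (w - 1).re = 0 := by rw [h]; rfl
    simp at this
    linarith
  have hpi : (π : ℂ) ≠ 0 := by exact_mod_cast pi_ne_zero
  rw [xiLaplace_eq (by linarith), Gamma_eq_stirling (by rw [(re_gamma_and_zeta_arguments w).1]; linarith), logXi,
    Complex.exp_add, Complex.exp_add, Complex.exp_add, Complex.exp_add, Complex.exp_sub,
    Complex.exp_log hz, Complex.exp_log hw1, ← Complex.ofReal_exp, ← Complex.ofReal_exp,
    Real.exp_log (by norm_num), Real.exp_log (by positivity), Complex.cpow_def_of_ne_zero hpi,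
    ← Complex.ofReal_log pi_pos.le]
  push_cast
  ring_nf

theorem hasDerivAt_logXi {w : ℂ} (hw : 7 ≤ w.re) :
    HasDerivAt logXi (1 / (w - 1) - 1 / 4 * Real.log π + 1 / 4 * (Complex.log ((5 + w) / 4)
      - 1 / 2 / ((5 + w) / 4) + deriv stirlingRemainder ((5 + w) / 4))
      + 1 / 2 * (deriv riemannZeta ((1 + w) / 2) / riemannZeta ((1 + w) / 2))) w := by
  obtain ⟨r1, -, r2⟩ := re_gamma_and_zeta_arguments w
  have hs0 : (5 + w) / 4 ≠ 0 := fun h => by rw [h] at r1; simp at r1; linarith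
  have hz := norm_riemannZeta_sub_one_le_half (s := (1 + w) / 2) (by rw [r2]; linarith)
  -- Being within $1/2$ of 1, $\zeta$ avoids the cut of the principal logarithm.
  have hzre : 0 < (riemannZeta ((1 + w) / 2)).re := by
    have := (abs_le.1 ((Complex.abs_re_le_norm _).trans hz)).1
    rw [Complex.sub_re, Complex.one_re] at this
    linarith
  have d0 := hasDerivAt_id w
  have d1 : HasDerivAt (fun w => Complex.log (w - 1)) (1 / (w - 1)) w :=
    (d0.sub_const 1).clog (Or.inl (by simp; linarith))
  have d2 : HasDerivAt (fun w : ℂ => (5 + w) / 4) (1 / 4) w := (d0.const_add 5).div_const 4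
  have d3 : HasDerivAt (fun w : ℂ => (1 + w) / 2) (1 / 2) w := (d0.const_add 1).div_const 2
  have d4 : HasDerivAt (fun w : ℂ => -(1 + w) / 4 * Real.log π) (-1 / 4 * Real.log π) w :=
    (((d0.const_add 1).neg).div_const 4).mul_const _
  have d5 : HasDerivAt (fun w : ℂ => Complex.log ((5 + w) / 4)) (1 / 4 / ((5 + w) / 4)) w :=
    d2.clog (Or.inl (by rw [r1]; linarith))
  have d6 : HasDerivAt (fun w : ℂ => stirlingRemainder ((5 + w) / 4))
      (deriv stirlingRemainder ((5 + w) / 4) * (1 / 4)) w := by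
    have h := (differentiableOn_stirlingRemainder.differentiableAt
      ((isOpen_lt continuous_const Complex.continuous_re).mem_nhds
        (show 1 / 2 < ((5 + w) / 4).re by rw [r1]; linarith))).hasDerivAt
    exact h.comp w d2
  have d7 : HasDerivAt (fun w : ℂ => riemannZeta ((1 + w) / 2))
      (deriv riemannZeta ((1 + w) / 2) * (1 / 2)) w :=
    HasDerivAt.comp w (differentiableAt_riemannZeta_of_one_lt
      (by rw [r2]; linarith)).hasDerivAt d3
  have d8 := d7.clog (Or.inl hzre)
  have := ((((d1.sub_const (Real.log 8 : ℂ)).add d4).add_const (Real.log √(2 * π) : ℂ)).add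
    ((((d2.sub_const (1 / 2)).mul d5).sub d2).add d6)).add d8
  refine HasDerivAt.congr_deriv this ?_
  have h5 : 5 + w ≠ 0 := fun h => hs0 (by rw [h]; simp)
  have key : ((5 + w) / 4 - 1 / 2) * (1 / 4 / ((5 + w) / 4)) - 1 / 4
      = -(1 / 4) * (1 / 2 / ((5 + w) / 4)) := by
    field_simp
    ring
  linear_combination key

theorem norm_deriv_logXi_sub_le {w : ℂ} (hw : 7 ≤ w.re) :
    ‖deriv logXi w - 1 / 4 * Complex.log (w / (4 * π))‖
      ≤ 11 / ‖w‖ + 8 * Real.exp (-(w.re / 4)) := by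
  obtain ⟨r1, -, r2⟩ := re_gamma_and_zeta_arguments w
  have hn : 7 ≤ ‖w‖ := hw.trans (Complex.re_le_norm w)
  have hn0 : 0 < ‖w‖ := by linarith
  have hw0 : w ≠ 0 := norm_pos_iff.1 hn0
  have h5 : w + (5 : ℝ) ≠ 0 := fun h => by
    have : (w + (5 : ℝ)).re = 0 := by rw [h]; rfl
    simp at this
    linarith
  have e1 : Complex.log ((5 + w) / 4) = Complex.log (w + (5 : ℝ)) - Real.log 4 := by
    rw [show (5 + w) / 4 = (w + (5 : ℝ)) * ((1 / 4 : ℝ) : ℂ) by push_cast; ring,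
      Complex.log_mul_ofReal _ (by norm_num) _ h5, one_div, Real.log_inv]
    push_cast
    ring
  have e2 : Complex.log (w / (4 * π)) = Complex.log w - Real.log 4 - Real.log π := by
    rw [show w / (4 * π) = w * ((1 / (4 * π) : ℝ) : ℂ) by push_cast; ring,
      Complex.log_mul_ofReal _ (by positivity) _ hw0, one_div, Real.log_inv,
      Real.log_mul (by norm_num) pi_ne_zero]
    push_cast
    ring
  have b1 : ‖Complex.log (w + (5 : ℝ)) - Complex.log w‖ ≤ 5 / ‖w‖ := by
    have := norm_log_sub_log_le (a := w + (5 : ℝ)) (b := w) (m := ‖w‖) (by simp; linarith)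
      (by linarith) (fun p hp => ?_) hn0
    · simpa using this
    · rw [segment_eq_image'] at hp
      obtain ⟨x, hx, rfl⟩ := hp
      have h := norm_le_norm_add_ofReal (v := w) (by linarith) (x := x * 5)
        (by have := hx.1; positivity)
      simpa using h
  have b2 : ‖1 / (w - 1)‖ ≤ 7 / 6 / ‖w‖ := by
    have : 6 / 7 * ‖w‖ ≤ ‖w - 1‖ := by
      have := norm_sub_norm_le w 1
      rw [norm_one] at this
      linarith
    rw [norm_div, norm_one]
    calc 1 / ‖w - 1‖ ≤ 1 / (6 / 7 * ‖w‖) := by gcongr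
      _ = _ := by field_simp
  have hs : ‖w‖ / 4 ≤ ‖(5 + w) / 4‖ := by
    have h := norm_le_norm_add_ofReal (v := w) (by linarith) (x := 5) (by norm_num)
    rw [norm_div, add_comm]
    simp only [Complex.ofReal_ofNat] at h
    rw [Complex.norm_ofNat]
    gcongr
  have b3 : ‖(1 / 2 / ((5 + w) / 4) : ℂ)‖ ≤ 2 / ‖w‖ := by
    rw [norm_div, show ‖(1 / 2 : ℂ)‖ = 1 / 2 by norm_num]
    calc 1 / 2 / ‖(5 + w) / 4‖ ≤ 1 / 2 / (‖w‖ / 4) := by gcongr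
      _ = _ := by field_simp; norm_num
  have b4 : ‖deriv stirlingRemainder ((5 + w) / 4)‖ ≤ 32 / ‖w‖ := by
    refine (norm_deriv_stirlingRemainder_le (by rw [r1]; linarith)).trans ?_
    calc 8 / ‖(5 + w) / 4‖ ≤ 8 / (‖w‖ / 4) := by gcongr
      _ = _ := by field_simp; norm_num
  have b5 : ‖deriv riemannZeta ((1 + w) / 2) / riemannZeta ((1 + w) / 2)‖
      ≤ 16 * Real.exp (-(w.re / 4)) := by
    have z1 := norm_deriv_riemannZeta_le (s := (1 + w) / 2) (by rw [r2]; linarith)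
    have z2 := half_le_norm_riemannZeta (s := (1 + w) / 2) (by rw [r2]; linarith)
    have hrp : (2 : ℝ) ^ (3 - ((1 + w) / 2).re) ≤ 8 * Real.exp (-(w.re / 4)) := by
      rw [Real.rpow_sub (by norm_num), r2, Real.rpow_def_of_pos (by norm_num) ((1 + w.re) / 2),
        div_eq_mul_inv, ← Real.exp_neg]
      have : Real.exp (-(Real.log 2 * ((1 + w.re) / 2))) ≤ Real.exp (-(w.re / 4)) := by
        refine Real.exp_le_exp.2 ?_
        have := Real.log_two_gt_d9
        nlinarith
      have h8 : (2 : ℝ) ^ (3 : ℝ) = 8 := by norm_num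
      rw [h8]
      gcongr
    rw [norm_div]
    calc _ ≤ 8 * Real.exp (-(w.re / 4)) / (1 / 2) := by
          gcongr
          exact z1.trans hrp
      _ = _ := by ring
  rw [(hasDerivAt_logXi hw).deriv, e1, e2]
  have e : (1 / (w - 1) - 1 / 4 * Real.log π + 1 / 4 * (Complex.log (w + (5 : ℝ)) - Real.log 4
      - 1 / 2 / ((5 + w) / 4) + deriv stirlingRemainder ((5 + w) / 4))
      + 1 / 2 * (deriv riemannZeta ((1 + w) / 2) / riemannZeta ((1 + w) / 2))
      - 1 / 4 * (Complex.log w - Real.log 4 - Real.log π))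
      = 1 / (w - 1) + 1 / 4 * (Complex.log (w + (5 : ℝ)) - Complex.log w)
        - 1 / 4 * (1 / 2 / ((5 + w) / 4)) + 1 / 4 * deriv stirlingRemainder ((5 + w) / 4)
        + 1 / 2 * (deriv riemannZeta ((1 + w) / 2) / riemannZeta ((1 + w) / 2)) := by ring
  rw [e]
  -- The coefficients of $1/\|w\|$ add up to $\frac76+\frac54+\frac12+8<11$.
  refine (norm_add_le _ _).trans ((add_le_add_left ((norm_add_le _ _).trans (add_le_add_left
    ((norm_sub_le _ _).trans (add_le_add_left (norm_add_le _ _) _)) _)) _).trans ?_)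
  simp only [norm_mul (1 / 4 : ℂ), norm_mul (1 / 2 : ℂ), show ‖(1 / 4 : ℂ)‖ = 1 / 4 by norm_num,
    show ‖(1 / 2 : ℂ)‖ = 1 / 2 by norm_num]
  have hh : 11 / ‖w‖ = 11 * (1 / ‖w‖) := by ring
  have h1 : 5 / ‖w‖ = 5 * (1 / ‖w‖) := by ring
  have h2 : 7 / 6 / ‖w‖ = 7 / 6 * (1 / ‖w‖) := by ring
  have h3 : 2 / ‖w‖ = 2 * (1 / ‖w‖) := by ring
  have h4 : 32 / ‖w‖ = 32 * (1 / ‖w‖) := by ring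
  have h0 : 0 < 1 / ‖w‖ := by positivity
  rw [hh]
  rw [h1] at b1
  rw [h2] at b2
  rw [h3] at b3
  rw [h4] at b4
  linarith

/-- In Stirling's formula only $-\Im s\arg s$, with $s=(5+w)/4$, is of the order of $|\Im w|$; every
other term is absorbed by $(1+\Re w)\log(2+\|w\|)$. -/
theorem abs_re_logXi_add_le {w : ℂ} (hw : 7 ≤ w.re) :
    |(logXi w).re + π * |w.im| / 8| ≤ 12 * ((1 + w.re) * Real.log (2 + ‖w‖)) := by
  obtain ⟨r1, r3, r2⟩ := re_gamma_and_zeta_arguments w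
  have hn : w.re ≤ ‖w‖ := Complex.re_le_norm w
  set s := (5 + w) / 4 with hs
  set a := w.re with ha
  set M := Real.log (2 + ‖w‖) with hM
  have hM1 : 1 ≤ M := by
    rw [hM, Real.le_log_iff_exp_le (by linarith)]
    linarith [Real.exp_one_lt_d9]
  have haM : 1 + a ≤ (1 + a) * M := le_mul_of_one_le_right (by linarith) hM1
  have hMa : M ≤ (1 + a) * M := le_mul_of_one_le_left (by linarith) (by linarith)
  have hpi3 := pi_gt_three
  have hpi4 := pi_le_four
  have hlogpi0 : 0 ≤ Real.log π := Real.log_nonneg (by linarith)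
  have hlogpi : Real.log π ≤ 3 := (Real.log_le_sub_one_of_pos pi_pos).trans (by linarith)
  have hz := norm_riemannZeta_sub_one_le_half (s := (1 + w) / 2) (by rw [r2]; linarith)
  have hz2 := half_le_norm_riemannZeta (s := (1 + w) / 2) (by rw [r2]; linarith)
  have hre : (logXi w).re = Real.log ‖w - 1‖ - Real.log 8 - (1 + a) / 4 * Real.log π
      + Real.log √(2 * π) + ((s.re - 1 / 2) * Real.log ‖s‖ - s.im * Complex.arg s - s.re
      + (stirlingRemainder s).re) + Real.log ‖riemannZeta ((1 + w) / 2)‖ := by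
    have e4 : (-(1 + w) / 4).re = -(1 + a) / 4 := by
      rw [show -(1 + w) / 4 = -(1 + w) / (4 : ℝ) by norm_num, Complex.div_ofReal_re]; simp [ha]
    have ehr : (s - 1 / 2).re = s.re - 1 / 2 := by
      rw [Complex.sub_re, show (1 / 2 : ℂ) = ((1 / 2 : ℝ) : ℂ) by norm_num, Complex.ofReal_re]
    have ehi : (s - 1 / 2).im = s.im := by
      rw [Complex.sub_im, show (1 / 2 : ℂ) = ((1 / 2 : ℝ) : ℂ) by norm_num, Complex.ofReal_im,
        sub_zero]
    rw [logXi, ← hs]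
    simp only [Complex.add_re, Complex.sub_re, Complex.log_re, Complex.ofReal_re,
      Complex.re_mul_ofReal, Complex.mul_re (s - 1 / 2), Complex.log_im, ehr, ehi, e4]
    ring
  have hs1 : s.re = (5 + a) / 4 := r1
  have hsn : s.re ≤ ‖s‖ := Complex.re_le_norm s
  have hsn2 : ‖s‖ ≤ 2 + ‖w‖ := by
    rw [hs, norm_div, Complex.norm_ofNat]
    have := norm_add_le 5 w
    rw [Complex.norm_ofNat] at this
    linarith
  have t1 : |Real.log ‖w - 1‖| ≤ M := by
    have u1 := norm_sub_norm_le w 1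
    have u2 := norm_sub_le w 1
    rw [norm_one] at u1 u2
    rw [abs_of_nonneg (Real.log_nonneg (by linarith))]
    exact Real.log_le_log (by linarith) (by linarith)
  have t2 : |Real.log 8| ≤ 7 := by
    rw [abs_of_nonneg (Real.log_nonneg (by norm_num))]
    exact (Real.log_le_sub_one_of_pos (by norm_num)).trans (by norm_num)
  have t3 : |(1 + a) / 4 * Real.log π| ≤ 1 + a := by
    rw [abs_of_nonneg (by positivity)]
    nlinarith
  have t4 : |Real.log √(2 * π)| ≤ 4 := by
    rw [Real.log_sqrt (by positivity), Real.log_mul (by norm_num) pi_ne_zero]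
    have := Real.log_two_gt_d9
    have := Real.log_two_lt_d9
    rw [abs_of_nonneg (by linarith)]
    linarith
  have t5 : |(s.re - 1 / 2) * Real.log ‖s‖| ≤ (1 + a) * M := by
    have l0 : 0 ≤ Real.log ‖s‖ := Real.log_nonneg (by linarith)
    rw [abs_of_nonneg (mul_nonneg (by linarith) l0)]
    have : Real.log ‖s‖ ≤ M := Real.log_le_log (by linarith) hsn2
    exact mul_le_mul (by linarith) this l0 (by linarith)
  have t6 := abs_im_mul_arg_sub_le (s := s) (by linarith)
  have t7 : |(stirlingRemainder s).re| ≤ 1 := by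
    refine (Complex.abs_re_le_norm _).trans
      ((norm_stirlingRemainder_le (by linarith) (by linarith)).trans ?_)
    rw [div_le_one (by linarith)]
    linarith
  have t8 : |Real.log ‖riemannZeta ((1 + w) / 2)‖| ≤ 1 := by
    have hup : ‖riemannZeta ((1 + w) / 2)‖ ≤ 3 / 2 := by
      have := norm_sub_norm_le (riemannZeta ((1 + w) / 2)) 1
      rw [norm_one] at this
      linarith
    rw [abs_le]
    constructor
    · have := Real.log_le_log (by norm_num) hz2
      rw [one_div, Real.log_inv] at this
      linarith [Real.log_two_lt_d9]
    · exact (Real.log_le_sub_one_of_pos (by linarith)).trans (by linarith)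
  have t9 : π * |w.im| / 8 = π / 2 * |s.im| := by
    rw [r3, abs_div, abs_of_pos (show (0 : ℝ) < 4 by norm_num)]
    ring
  rw [hre, t9]
  have t6' : π / 2 * s.re ≤ 2 * s.re := by
    have : 0 ≤ s.re := by linarith
    nlinarith
  rw [abs_le] at t1 t2 t3 t4 t5 t6 t7 t8 ⊢
  constructor <;> linarith

/-! ### Perturbed Gaussian integrals. -/

/-- With $y=1+r^2$: $y\le4e^{y/4}$ and $e^{1/2}\le7/4$. -/
theorem one_add_sq_mul_exp_le (r : ℝ) :
    (1 + r ^ 2) * Real.exp (1 / 4 * (1 + r ^ 2)) ≤ 7 * Real.exp (r ^ 2 / 2) := by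
  have h1 : 1 + r ^ 2 ≤ 4 * Real.exp (1 / 4 * (1 + r ^ 2)) := by
    linarith [Real.add_one_le_exp (1 / 4 * (1 + r ^ 2))]
  have h2 : Real.exp (1 / 4 * (1 + r ^ 2)) * Real.exp (1 / 4 * (1 + r ^ 2))
      = Real.exp (1 / 2) * Real.exp (r ^ 2 / 2) := by
    rw [← Real.exp_add, ← Real.exp_add]
    ring_nf
  have h3 : Real.exp (1 / 2) ≤ 7 / 4 := by
    have h4 : Real.exp (1 / 2) * Real.exp (1 / 2) = Real.exp 1 := by
      rw [← Real.exp_add]; norm_num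
    have := Real.exp_one_lt_d9
    have := Real.exp_pos (1 / 2)
    nlinarith
  calc _ ≤ 4 * Real.exp (1 / 4 * (1 + r ^ 2)) * Real.exp (1 / 4 * (1 + r ^ 2)) := by gcongr
    _ = 4 * (Real.exp (1 / 2) * Real.exp (r ^ 2 / 2)) := by rw [mul_assoc, h2]
    _ ≤ 4 * (7 / 4 * Real.exp (r ^ 2 / 2)) := by gcongr
    _ = _ := by ring

theorem integral_exp_neg_sq_div_two : ∫ r : ℝ, Real.exp (-(1 / 2) * r ^ 2) = √2 * √π := by
  rw [integral_gaussian, ← Real.sqrt_mul (by norm_num)]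
  congr 1
  ring

theorem integrable_exp_neg_sq_div_two : Integrable fun r : ℝ => Real.exp (-(1 / 2) * r ^ 2) :=
  integrable_exp_neg_mul_sq (by norm_num)

theorem sqrt_two_le : √2 ≤ 10 / 7 := by
  rw [Real.sqrt_le_left (by norm_num)]
  norm_num

theorem norm_cexp_neg_sq_add_le {g : ℂ} {r : ℝ} (hg : ‖g‖ ≤ 1 / 20 * (1 + r ^ 2)) :
    ‖Complex.exp (-(r : ℂ) ^ 2 + g)‖ ≤ Real.exp (-r ^ 2) * Real.exp (1 / 20 * (1 + r ^ 2)) := by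
  rw [Complex.norm_exp, ← Real.exp_add, Complex.add_re]
  refine Real.exp_le_exp.2 ?_
  have h1 : (-(r : ℂ) ^ 2).re = -r ^ 2 := by
    rw [← Complex.ofReal_pow, ← Complex.ofReal_neg, Complex.ofReal_re]
  rw [h1]
  linarith [Complex.re_le_norm g]

theorem norm_perturbed_gaussian_mul_le {g h : ℂ} {r D : ℝ} (hg : ‖g‖ ≤ 1 / 20 * (1 + r ^ 2))
    (hD : 0 ≤ D) (hh : ‖h‖ ≤ D * (1 + r ^ 2)) :
    ‖Complex.exp (-(r : ℂ) ^ 2 + g) * h‖ ≤ 7 * D * Real.exp (-(1 / 2) * r ^ 2) := by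
  rw [norm_mul]
  calc _ ≤ (Real.exp (-r ^ 2) * Real.exp (1 / 20 * (1 + r ^ 2))) * (D * (1 + r ^ 2)) := by
        gcongr
        exact norm_cexp_neg_sq_add_le hg
    _ ≤ (Real.exp (-r ^ 2) * Real.exp (1 / 4 * (1 + r ^ 2))) * (D * (1 + r ^ 2)) := by
        gcongr
        norm_num
    _ = D * Real.exp (-r ^ 2) * ((1 + r ^ 2) * Real.exp (1 / 4 * (1 + r ^ 2))) := by ring
    _ ≤ D * Real.exp (-r ^ 2) * (7 * Real.exp (r ^ 2 / 2)) := by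
        exact mul_le_mul_of_nonneg_left (one_add_sq_mul_exp_le r) (by positivity)
    _ = 7 * D * (Real.exp (-r ^ 2) * Real.exp (r ^ 2 / 2)) := by ring
    _ = _ := by rw [← Real.exp_add]; ring_nf

theorem norm_integral_perturbed_gaussian_mul_le {g h : ℝ → ℂ} {D : ℝ}
    (hg : ∀ r, ‖g r‖ ≤ 1 / 20 * (1 + r ^ 2)) (hD : 0 ≤ D) (hh : ∀ r, ‖h r‖ ≤ D * (1 + r ^ 2)) :
    ‖∫ r : ℝ, Complex.exp (-(r : ℂ) ^ 2 + g r) * h r‖ ≤ 10 * D * √π := by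
  have key : ‖∫ r : ℝ, Complex.exp (-(r : ℂ) ^ 2 + g r) * h r‖
      ≤ ∫ r : ℝ, 7 * D * Real.exp (-(1 / 2) * r ^ 2) :=
    norm_integral_le_of_norm_le (integrable_exp_neg_sq_div_two.const_mul _)
      (Eventually.of_forall fun r => norm_perturbed_gaussian_mul_le (hg r) hD (hh r))
  rw [integral_const_mul, integral_exp_neg_sq_div_two] at key
  refine key.trans ?_
  have := sqrt_two_le
  have h2 : 0 ≤ D * √π := by positivity
  nlinarith

/-- From $|e^g-1|\le|g|e^{|g|}$. The constant $1/20$ is small enough that the loss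
$\frac7{20}\sqrt2$ is at most $\frac12$, which keeps the integral away from 0. -/
theorem norm_integral_perturbed_gaussian_sub_le {g : ℝ → ℂ} (hgc : Continuous g)
    (hg : ∀ r, ‖g r‖ ≤ 1 / 20 * (1 + r ^ 2)) :
    ‖(∫ r : ℝ, Complex.exp (-(r : ℂ) ^ 2 + g r)) - (√π : ℝ)‖ ≤ √π / 2 := by
  have e0 : ∫ r : ℝ, Complex.exp (-(r : ℂ) ^ 2) = (√π : ℝ) := by
    simpa using integral_cexp_neg_sq_add_mul 0
  have i0 : Integrable fun r : ℝ => Complex.exp (-(r : ℂ) ^ 2) := by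
    simpa using integrable_cexp_neg_sq_add_mul 0
  have hbd : ∀ r : ℝ, ‖Complex.exp (-(r : ℂ) ^ 2 + g r) - Complex.exp (-(r : ℂ) ^ 2)‖
      ≤ 7 / 20 * Real.exp (-(1 / 2) * r ^ 2) := fun r => by
    have h1 : Complex.exp (-(r : ℂ) ^ 2 + g r) - Complex.exp (-(r : ℂ) ^ 2)
        = Complex.exp (-(r : ℂ) ^ 2) * (Complex.exp (g r) - 1) := by
      rw [Complex.exp_add]; ring
    have h2 : ‖Complex.exp (-(r : ℂ) ^ 2)‖ = Real.exp (-r ^ 2) := by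
      rw [← Complex.ofReal_pow, ← Complex.ofReal_neg, ← Complex.ofReal_exp, Complex.norm_real,
        Real.norm_eq_abs, Real.abs_exp]
    have h3 : ‖Complex.exp (g r) - 1‖ ≤ ‖g r‖ * Real.exp ‖g r‖ := by
      simpa using Complex.norm_exp_sub_sum_le_norm_mul_exp (g r) 1
    rw [h1, norm_mul, h2]
    calc _ ≤ Real.exp (-r ^ 2) * (1 / 20 * (1 + r ^ 2) * Real.exp (1 / 20 * (1 + r ^ 2))) := by
          gcongr
          exact h3.trans (mul_le_mul (hg r) (Real.exp_le_exp.2 (hg r)) (Real.exp_pos _).le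
            (by positivity))
      _ ≤ Real.exp (-r ^ 2) * (1 / 20 * (1 + r ^ 2) * Real.exp (1 / 4 * (1 + r ^ 2))) := by
          gcongr
          norm_num
      _ = 1 / 20 * Real.exp (-r ^ 2) * ((1 + r ^ 2) * Real.exp (1 / 4 * (1 + r ^ 2))) := by ring
      _ ≤ 1 / 20 * Real.exp (-r ^ 2) * (7 * Real.exp (r ^ 2 / 2)) := by
          exact mul_le_mul_of_nonneg_left (one_add_sq_mul_exp_le r) (by positivity)
      _ = 7 / 20 * (Real.exp (-r ^ 2) * Real.exp (r ^ 2 / 2)) := by ring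
      _ = _ := by rw [← Real.exp_add]; ring_nf
  have i2 := (integrable_exp_neg_sq_div_two.const_mul (7 / 20)).mono'
    (Continuous.aestronglyMeasurable (by fun_prop)) (Eventually.of_forall hbd)
  have i1 : Integrable fun r : ℝ => Complex.exp (-(r : ℂ) ^ 2 + g r) := by
    exact (i2.add i0).congr (Eventually.of_forall fun r => by simp)
  rw [← e0, ← integral_sub i1 i0]
  refine (norm_integral_le_of_norm_le (integrable_exp_neg_sq_div_two.const_mul (7 / 20))
    (Eventually.of_forall hbd)).trans ?_
  rw [integral_const_mul, integral_exp_neg_sq_div_two]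
  have := sqrt_two_le
  have h2 : 0 ≤ √π := by positivity
  nlinarith

/-! ### Geometry of the saddle line and variation of `logXi`$'$ along it. -/

theorem logPlus_ge (x : ℝ) : 1 / 2 ≤ logPlus x := by
  have h := Real.log_le_log (by norm_num) (show 2 ≤ 2 + |x| by linarith [abs_nonneg x])
  have := Real.log_two_gt_d9
  rw [logPlus]
  linarith

theorem logPlus_le_of_nonneg {x : ℝ} (hx : 0 ≤ x) : logPlus x ≤ 1 + x := by
  rw [logPlus, abs_of_nonneg hx]
  exact (Real.log_le_sub_one_of_pos (by linarith)).trans (by linarith)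

/-- The point `i z` for `z = x - i κ log₊ x`. -/
def base (κ x : ℝ) : ℂ := (κ * logPlus x : ℝ) + Complex.I * x

/-- The expected logarithmic derivative at `base κ x`. -/
def slope (κ x : ℝ) : ℂ := 1 / 4 * Complex.log (base κ x / (4 * π))

/-- The vertical line through the saddle point. -/
def saddleLine (σ κ x r : ℝ) : ℂ :=
  base κ x - 2 * σ ^ 2 * slope κ x + 2 * Complex.I * σ * r

/-- The standing hypotheses of the saddle-point estimates. -/
structure Admissible (M σ κ x : ℝ) : Prop where
  one_le : 1 ≤ M
  sigma_nonneg : 0 ≤ σ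
  sq_le : σ ^ 2 ≤ M
  kappa_ge : 14400 * M ^ 2 ≤ √κ
  x_nonneg : 0 ≤ x

theorem abs_le_one_add_sq (r : ℝ) : |r| ≤ (1 + r ^ 2) / 2 := by
  have := sq_abs r
  nlinarith [sq_nonneg (|r| - 1)]

namespace Admissible

variable {M σ κ x : ℝ}

theorem sqrt_ge (h : Admissible M σ κ x) : 14400 ≤ √κ ∧ 14400 * M ≤ √κ := by
  have := h.one_le
  have := h.kappa_ge
  constructor <;> nlinarith

theorem sq_sqrt (h : Admissible M σ κ x) : √κ ^ 2 = κ := by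
  refine Real.sq_sqrt ?_
  by_contra hneg
  have h1 := h.sqrt_ge.1
  rw [Real.sqrt_eq_zero_of_nonpos (by linarith)] at h1
  norm_num at h1

theorem sigma_le (h : Admissible M σ κ x) : σ ≤ M := by
  have := h.one_le
  have := h.sq_le
  nlinarith [h.sigma_nonneg]

theorem base_re : (base κ x).re = κ * logPlus x := by simp [base]

theorem base_im : (base κ x).im = x := by simp [base]

theorem le_norm_base : x ≤ ‖base κ x‖ := by
  have := Complex.abs_im_le_norm (base κ x)
  rw [base_im] at this
  exact (le_abs_self x).trans this

theorem seven_le_half (h : Admissible M σ κ x) : 7 ≤ κ * logPlus x / 2 := by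
  have h1 := h.sqrt_ge.1
  have h2 := h.sq_sqrt
  have h3 := logPlus_ge x
  have : 14400 ≤ κ := by nlinarith
  nlinarith

theorem norm_base_le (h : Admissible M σ κ x) : ‖base κ x‖ ≤ (κ + 1) * (2 + x) := by
  have h1 := h.sqrt_ge.1
  have h2 := h.sq_sqrt
  have h3 := logPlus_le_of_nonneg h.x_nonneg
  have h4 := logPlus_ge x
  have hx := h.x_nonneg
  have hκ : 0 ≤ κ := by nlinarith
  refine (norm_add_le _ _).trans ?_
  rw [norm_mul, Complex.norm_I, one_mul, Complex.norm_real, Complex.norm_real,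
    Real.norm_of_nonneg (by positivity), Real.norm_of_nonneg hx]
  nlinarith

/-- The gain is $\sqrt\kappa$ in place of $\kappa$, from $\log(\kappa+1)\le2\sqrt\kappa$: for large
$\kappa$ the shift $2\sigma^2\cdot$`slope` is then small against $\Re(iz)=\kappa\log_+x$. -/
theorem norm_slope_le (h : Admissible M σ κ x) : ‖slope κ x‖ ≤ 4 * √κ * logPlus x := by
  have h1 := h.sqrt_ge.1
  have h2 := h.sq_sqrt
  have h4 := logPlus_ge x
  have hx := h.x_nonneg
  have h5 := h.seven_le_half
  have hκ : 0 ≤ κ := by nlinarith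
  have hre : 14 ≤ (base κ x).re := by rw [base_re]; linarith
  have hb1 : 14 ≤ ‖base κ x‖ := hre.trans (Complex.re_le_norm _)
  have hb0 : base κ x ≠ 0 := norm_pos_iff.1 (by linarith)
  have harg : |Complex.arg (base κ x)| ≤ 2 := by
    have := Complex.abs_arg_lt_pi_div_two_iff.2 (Or.inl (by linarith : 0 < (base κ x).re))
    linarith [pi_le_four]
  have hlog0 : 0 ≤ Real.log ‖base κ x‖ := Real.log_nonneg (by linarith)
  have hlogκ : Real.log (κ + 1) ≤ 2 * √κ := by
    have e : κ + 1 ≤ (√κ + 1) ^ 2 := by nlinarith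
    calc Real.log (κ + 1) ≤ Real.log ((√κ + 1) ^ 2) := Real.log_le_log (by linarith) e
      _ = 2 * Real.log (√κ + 1) := by rw [Real.log_pow]; norm_num
      _ ≤ 2 * √κ := by
        have := Real.log_le_sub_one_of_pos (by linarith : 0 < √κ + 1)
        linarith
  have hlog1 : Real.log ‖base κ x‖ ≤ 2 * √κ + logPlus x := by
    refine (Real.log_le_log (by linarith) h.norm_base_le).trans ?_
    rw [Real.log_mul (by linarith) (by linarith)]
    have : logPlus x = Real.log (2 + x) := by rw [logPlus, abs_of_nonneg hx]
    linarith
  have hl4 : 0 ≤ Real.log (4 * π) ∧ Real.log (4 * π) ≤ 15 := by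
    have := pi_gt_three
    have := pi_le_four
    exact ⟨Real.log_nonneg (by linarith),
      (Real.log_le_sub_one_of_pos (by linarith)).trans (by linarith)⟩
  have e : Complex.log (base κ x / (4 * π)) = Complex.log (base κ x) - Real.log (4 * π) := by
    rw [show base κ x / (4 * π) = base κ x * ((1 / (4 * π) : ℝ) : ℂ) by push_cast; ring,
      Complex.log_mul_ofReal _ (by positivity) _ hb0, one_div, Real.log_inv]
    push_cast
    ring
  have hn : ‖Complex.log (base κ x)‖ ≤ 2 * √κ + logPlus x + 2 := by
    refine (Complex.norm_le_abs_re_add_abs_im _).trans ?_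
    rw [Complex.log_re, Complex.log_im, abs_of_nonneg hlog0]
    linarith
  rw [slope, norm_mul, e, show ‖(1 / 4 : ℂ)‖ = 1 / 4 by norm_num]
  have hsub := norm_sub_le (Complex.log (base κ x)) (Real.log (4 * π) : ℂ)
  rw [Complex.norm_real, Real.norm_of_nonneg hl4.1] at hsub
  nlinarith

theorem norm_sub_base_le (h : Admissible M σ κ x) (r : ℝ) :
    ‖saddleLine σ κ x r - base κ x‖ ≤ 8 * M * √κ * logPlus x + 2 * M * |r| := by
  have e : saddleLine σ κ x r - base κ x
      = -(2 * σ ^ 2 * slope κ x) + 2 * Complex.I * σ * r := by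
    rw [saddleLine]; ring
  rw [e]
  refine (norm_add_le _ _).trans ?_
  rw [norm_neg]
  simp only [norm_mul, norm_pow, Complex.norm_real, Complex.norm_I, Complex.norm_ofNat, mul_one,
    Real.norm_eq_abs]
  rw [abs_of_nonneg h.sigma_nonneg]
  have h1 := h.norm_slope_le
  have h2 : 0 ≤ ‖slope κ x‖ := norm_nonneg _
  have h3 := h.sq_le
  have h4 := h.sigma_le
  calc _ ≤ 2 * M * (4 * √κ * logPlus x) + 2 * M * |r| := by
        have := h.one_le
        gcongr
    _ = _ := by ring

theorem re_saddleLine (r : ℝ) : (saddleLine σ κ x r).re = (saddleLine σ κ x 0).re := by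
  simp [saddleLine]

/-- The shift to the saddle costs at most half of the real part, since $16M\le\sqrt\kappa$. -/
theorem le_re_saddleLine (h : Admissible M σ κ x) (r : ℝ) :
    κ * logPlus x / 2 ≤ (saddleLine σ κ x r).re := by
  have h1 := (Complex.abs_re_le_norm _).trans (h.norm_sub_base_le 0)
  rw [abs_zero, mul_zero, add_zero, Complex.sub_re, base_re] at h1
  have h2 := (abs_le.1 h1).1
  have h3 := h.sqrt_ge
  have h4 := logPlus_ge x
  have h5 := h.sq_sqrt
  have h6 : 8 * M * √κ * logPlus x ≤ κ * logPlus x / 2 := by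
    have : 16 * M * √κ ≤ κ := by
      have : 16 * M * √κ ≤ √κ ^ 2 := by nlinarith
      linarith
    nlinarith
  rw [re_saddleLine r]
  linarith

theorem seven_le_re (h : Admissible M σ κ x) (r : ℝ) : 7 ≤ (saddleLine σ κ x r).re :=
  h.seven_le_half.trans (h.le_re_saddleLine r)

theorem le_base_re (h : Admissible M σ κ x) : κ * logPlus x / 2 ≤ (base κ x).re := by
  rw [base_re]
  linarith [h.seven_le_half]

/-- Two errors: that of the approximation $\frac14\log(v/4\pi)$ at $v$, and the change of this
logarithm between $v$ and $iz$. -/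
theorem norm_deriv_logXi_sub_slope_le (h : Admissible M σ κ x) (r : ℝ) :
    ‖deriv logXi (saddleLine σ κ x r) - slope κ x‖ ≤ 11 / ‖saddleLine σ κ x r‖
      + 8 * Real.exp (-((saddleLine σ κ x r).re / 4))
      + 1 / 4 * ‖Complex.log (saddleLine σ κ x r) - Complex.log (base κ x)‖ := by
  have h1 := norm_deriv_logXi_sub_le (h.seven_le_re r)
  set v := saddleLine σ κ x r with hv
  have hv0 : v ≠ 0 := fun h0 => by have := h.seven_le_re r; rw [← hv, h0] at this; norm_num at this
  have hb0 : base κ x ≠ 0 := fun h0 => by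
    have := h.seven_le_half.trans h.le_base_re; rw [h0] at this; norm_num at this
  have e : ∀ p : ℂ, p ≠ 0 →
      Complex.log (p / (4 * π)) = Complex.log p - Real.log (4 * π) := fun p hp => by
    rw [show p / (4 * π) = p * ((1 / (4 * π) : ℝ) : ℂ) by push_cast; ring,
      Complex.log_mul_ofReal _ (by positivity) _ hp, one_div, Real.log_inv]
    push_cast
    ring
  have e2 : deriv logXi v - slope κ x = (deriv logXi v - 1 / 4 * Complex.log (v / (4 * π)))
      + 1 / 4 * (Complex.log v - Complex.log (base κ x)) := by
    rw [slope, e v hv0, e _ hb0]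
    ring
  rw [e2]
  refine (norm_add_le _ _).trans (add_le_add h1 (le_of_eq ?_))
  rw [norm_mul, show ‖(1 / 4 : ℂ)‖ = 1 / 4 by norm_num]

theorem norm_log_sub_log_base_le (h : Admissible M σ κ x) (r : ℝ) :
    ‖Complex.log (saddleLine σ κ x r) - Complex.log (base κ x)‖
      ≤ (8 * M * √κ * logPlus x + 2 * M * |r|) / (κ * logPlus x / 2) := by
  have h7 := h.seven_le_half
  refine (norm_log_sub_log_le_of_le_re (by linarith) (h.le_re_saddleLine r) h.le_base_re).trans ?_
  gcongr
  exact h.norm_sub_base_le r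

/-- Smallness from $\kappa$ alone, uniformly in $x$; this controls the phase. The constant covers
$44+128+\frac{16}4$. -/
theorem norm_deriv_logXi_sub_slope_le_uniform (h : Admissible M σ κ x) (r : ℝ) :
    ‖deriv logXi (saddleLine σ κ x r) - slope κ x‖ ≤ 180 * M / √κ * (1 + |r|) := by
  have h0 := h.norm_deriv_logXi_sub_slope_le r
  have h1 := h.norm_log_sub_log_base_le r
  have hL := logPlus_ge x
  have hq := h.sqrt_ge.1
  have hM := h.one_le
  have h7 := h.seven_le_half
  have hre := h.le_re_saddleLine r
  have hn := hre.trans (Complex.re_le_norm _)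
  have hqp : 0 < √κ := by linarith
  have hm : √κ / 4 ≤ κ * logPlus x / 2 := by
    rw [← h.sq_sqrt, Real.sqrt_sq hqp.le]
    nlinarith
  have b1 : 11 / ‖saddleLine σ κ x r‖ ≤ 44 / √κ := by
    calc _ ≤ 11 / (√κ / 4) := by gcongr; linarith
      _ = _ := by field_simp; norm_num
  have b2 : 8 * Real.exp (-((saddleLine σ κ x r).re / 4)) ≤ 128 / √κ := by
    have hp : 0 < √κ / 16 := by positivity
    have e1 : Real.exp (-((saddleLine σ κ x r).re / 4)) ≤ Real.exp (-(√κ / 16)) :=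
      Real.exp_le_exp.2 (by linarith)
    have e2 : Real.exp (-(√κ / 16)) ≤ 16 / √κ := by
      rw [Real.exp_neg, inv_le_comm₀ (Real.exp_pos _) (by positivity), inv_div]
      linarith [Real.add_one_le_exp (√κ / 16)]
    calc _ ≤ 8 * (16 / √κ) := by gcongr; linarith
      _ = _ := by ring
  have b3 : (8 * M * √κ * logPlus x + 2 * M * |r|) / (κ * logPlus x / 2)
      ≤ 16 * M / √κ + 8 * M * |r| / √κ := by
    rw [add_div]
    refine add_le_add (le_of_eq ?_) ?_
    · have := h.sq_sqrt
      rw [div_eq_div_iff (by linarith) (by linarith)]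
      linear_combination (-8 * M * logPlus x + 16 * M * logPlus x) * this
    · calc 2 * M * |r| / (κ * logPlus x / 2) ≤ 2 * M * |r| / (√κ / 4) := by gcongr
        _ = _ := by field_simp; ring
  have e : 180 * M / √κ * (1 + |r|) = 180 * M * (1 / √κ) + 180 * M * (|r| * (1 / √κ)) := by ring
  have e1 : 44 / √κ = 44 * (1 / √κ) := by ring
  have e2 : 128 / √κ = 128 * (1 / √κ) := by ring
  have e3 : 16 * M / √κ + 8 * M * |r| / √κ = 16 * M * (1 / √κ) + 8 * M * (|r| * (1 / √κ)) := by
    ring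
  rw [e]
  rw [e1] at b1
  rw [e2] at b2
  rw [e3] at b3
  have p1 : 0 < 1 / √κ := by positivity
  have p2 : 0 ≤ |r| * (1 / √κ) := by positivity
  have p3 : 1 / √κ ≤ M * (1 / √κ) := le_mul_of_one_le_left p1.le hM
  have p4 : 0 ≤ M * (|r| * (1 / √κ)) := by positivity
  nlinarith

theorem norm_sub_base_le_mul (h : Admissible M σ κ x) (r : ℝ) :
    ‖saddleLine σ κ x r - base κ x‖ ≤ 8 * M * √κ * logPlus x * (1 + |r|) := by
  have hd := h.norm_sub_base_le r
  have hL := logPlus_ge x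
  have hq := h.sqrt_ge.1
  have hM := h.one_le
  have h8 : 1 ≤ √κ * logPlus x := by nlinarith
  have h9 : 0 ≤ M * |r| := by positivity
  have : M * |r| * 1 ≤ M * |r| * (√κ * logPlus x) := mul_le_mul_of_nonneg_left h8 h9
  linarith

theorem sixteen_mul_le (h : Admissible M σ κ x) : 16 * M * √κ ≤ κ := by
  have h3 := h.sqrt_ge
  have h5 := h.sq_sqrt
  have : 16 * M * √κ ≤ √κ ^ 2 := by nlinarith [h.one_le]
  linarith

/-- With $v$ on the line and $b=iz$, $\|v-b\|\le(1+|r|)\|v\|$, hence $x\le\|b\|\le(2+|r|)\|v\|$. -/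
theorem inv_norm_saddleLine_le (h : Admissible M σ κ x) (hx : 0 < x) (r : ℝ) :
    1 / ‖saddleLine σ κ x r‖ ≤ 6 * (logPlus x / x) * (1 + r ^ 2) := by
  have hE := h.norm_sub_base_le_mul r
  have hn := (h.le_re_saddleLine r).trans (Complex.re_le_norm _)
  have h16 := h.sixteen_mul_le
  have hL := logPlus_ge x
  have h7 := h.seven_le_half
  have hbx := le_norm_base (κ := κ) (x := x)
  have c1 := norm_sub_norm_le (base κ x) (saddleLine σ κ x r)
  rw [norm_sub_rev] at c1
  generalize saddleLine σ κ x r = v at *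
  generalize base κ x = b at *
  generalize logPlus x = L at *
  have hvp : 0 < ‖v‖ := by linarith
  have hrr := abs_le_one_add_sq r
  have c2 : 8 * M * √κ * L * (1 + |r|) ≤ ‖v‖ * (1 + |r|) := by
    refine mul_le_mul_of_nonneg_right ?_ (by positivity)
    nlinarith
  have d2 : 3 * (1 + r ^ 2) ≤ 6 * L * (1 + r ^ 2) :=
    mul_le_mul_of_nonneg_right (by linarith) (by positivity)
  have c3 : x ≤ (6 * L * (1 + r ^ 2)) * ‖v‖ := by
    calc x ≤ (2 + |r|) * ‖v‖ := by linarith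
      _ ≤ _ := mul_le_mul_of_nonneg_right (by linarith [sq_nonneg r]) hvp.le
  rw [div_le_iff₀ hvp, show 6 * (L / x) * (1 + r ^ 2) * ‖v‖ = (6 * L * (1 + r ^ 2) * ‖v‖) / x by
    ring]
  rwa [one_le_div hx]

/-- The real part is at least $4\log_+x$, and $e^{-\log_+x}=1/(2+x)$. -/
theorem exp_neg_re_saddleLine_le (h : Admissible M σ κ x) (hx : 0 < x) (r : ℝ) :
    Real.exp (-((saddleLine σ κ x r).re / 4)) ≤ 2 * (logPlus x / x) * (1 + r ^ 2) := by
  have hre := h.le_re_saddleLine r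
  have h16 := h.sixteen_mul_le
  have hL := logPlus_ge x
  have hM := h.one_le
  have hq := h.sqrt_ge.1
  have e1 : Real.exp (-((saddleLine σ κ x r).re / 4)) ≤ Real.exp (-logPlus x) := by
    refine Real.exp_le_exp.2 ?_
    have : 8 ≤ κ := by nlinarith
    nlinarith
  have e2 : Real.exp (-logPlus x) ≤ 1 / x := by
    rw [Real.exp_neg, logPlus, Real.exp_log (by positivity), abs_of_pos hx, ← one_div]
    gcongr
    linarith
  have e3 : 1 / x ≤ 2 * (logPlus x / x) * (1 + r ^ 2) := by
    rw [show 2 * (logPlus x / x) * (1 + r ^ 2) = (2 * logPlus x * (1 + r ^ 2)) / x by ring]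
    gcongr
    nlinarith [sq_nonneg r]
  linarith

theorem norm_log_sub_log_base_le_div (h : Admissible M σ κ x) (hx : 0 < x) (r : ℝ) :
    ‖Complex.log (saddleLine σ κ x r) - Complex.log (base κ x)‖
      ≤ (32 * M * √κ + 512 * M ^ 2) * (logPlus x / x) * (1 + r ^ 2) := by
  have hE := h.norm_sub_base_le_mul r
  have hre := h.le_re_saddleLine r
  have hreb := h.le_base_re
  have hM := h.one_le
  have hL := logPlus_ge x
  have hq := h.sqrt_ge.1
  have hsq := h.sq_sqrt
  have hm0 : 0 < κ * logPlus x / 2 := by linarith [h.seven_le_half]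
  have hbx := le_norm_base (κ := κ) (x := x)
  generalize saddleLine σ κ x r = v at *
  generalize base κ x = b at *
  generalize logPlus x = L at *
  have hrr := abs_le_one_add_sq r
  have hbp : 0 < ‖b‖ := by linarith
  have hEsq : ‖v - b‖ ^ 2 / (κ * L / 2) ≤ 256 * M ^ 2 * L * (1 + r ^ 2) := by
    rw [div_le_iff₀ hm0]
    have e1 : ‖v - b‖ ^ 2 ≤ (8 * M * √κ * L * (1 + |r|)) ^ 2 := by gcongr
    have e2 : (1 + |r|) ^ 2 ≤ 2 * (1 + r ^ 2) := by
      have := sq_abs r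
      nlinarith [sq_nonneg (|r| - 1)]
    calc ‖v - b‖ ^ 2 ≤ (8 * M * √κ * L * (1 + |r|)) ^ 2 := e1
      _ = 64 * M ^ 2 * √κ ^ 2 * L ^ 2 * (1 + |r|) ^ 2 := by ring
      _ ≤ 64 * M ^ 2 * √κ ^ 2 * L ^ 2 * (2 * (1 + r ^ 2)) := by gcongr
      _ = 64 * M ^ 2 * κ * L ^ 2 * (2 * (1 + r ^ 2)) := by rw [hsq]
      _ = _ := by ring
  have t1 : 2 * (‖v - b‖ / x) ≤ 32 * M * √κ * (L / x) * (1 + r ^ 2) := by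
    rw [show 32 * M * √κ * (L / x) * (1 + r ^ 2) = 2 * ((16 * M * √κ * L * (1 + r ^ 2)) / x) by
      ring]
    gcongr
    refine hE.trans ?_
    rw [show 16 * M * √κ * L * (1 + r ^ 2) = 8 * M * √κ * L * (2 * (1 + r ^ 2)) by ring]
    gcongr
    linarith [sq_nonneg r]
  have t2 : 2 * ((‖v - b‖ ^ 2 / (κ * L / 2)) / x) ≤ 512 * M ^ 2 * (L / x) * (1 + r ^ 2) := by
    rw [show 512 * M ^ 2 * (L / x) * (1 + r ^ 2) = 2 * ((256 * M ^ 2 * L * (1 + r ^ 2)) / x) by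
      ring]
    gcongr
  have p1 : 0 ≤ 2 * (‖v - b‖ / x) := by positivity
  have p2 : 0 ≤ 2 * ((‖v - b‖ ^ 2 / (κ * L / 2)) / x) := by positivity
  rw [add_mul, add_mul]
  -- Near $b$, the segment from $b$ to $v$ stays at distance at least $\|b\|/2\ge x/2$ from 0. Far
  -- from $b$, one has $2\|v-b\|/x\ge1$, and this factor is inserted into the cruder bound by the
  -- real parts; the resulting growth in $r$ is quadratic and harmless under the Gaussian.
  rcases le_or_gt ‖v - b‖ (‖b‖ / 2) with hc | hc
  · have hlog := norm_log_sub_log_le (a := v) (b := b) (m := ‖b‖ / 2) (by linarith)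
      (by linarith) (fun p hp => ?_) (by positivity)
    · have : ‖v - b‖ / (‖b‖ / 2) ≤ 2 * (‖v - b‖ / x) := by
        calc ‖v - b‖ / (‖b‖ / 2) ≤ ‖v - b‖ / (x / 2) := by gcongr
          _ = _ := by field_simp
      linarith
    · have h1 := norm_sub_le_of_mem_segment hp
      have h2 := norm_sub_norm_le b p
      rw [norm_sub_rev] at h2
      linarith
  · have hlog := norm_log_sub_log_le_of_le_re hm0 hre hreb
    have : ‖v - b‖ / (κ * L / 2) ≤ 2 * ((‖v - b‖ ^ 2 / (κ * L / 2)) / x) := by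
      rw [show 2 * ((‖v - b‖ ^ 2 / (κ * L / 2)) / x)
        = (‖v - b‖ / (κ * L / 2)) * (2 * ‖v - b‖ / x) by ring]
      refine le_mul_of_one_le_right (by positivity) ?_
      rw [one_le_div hx]
      linarith
    linarith

theorem norm_deriv_logXi_sub_slope_le_div (h : Admissible M σ κ x) (hx : 0 < x) (r : ℝ) :
    ‖deriv logXi (saddleLine σ κ x r) - slope κ x‖
      ≤ (82 + 8 * M * √κ + 128 * M ^ 2) * (logPlus x / x) * (1 + r ^ 2) := by
  have h0 := h.norm_deriv_logXi_sub_slope_le r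
  have b1 := h.inv_norm_saddleLine_le hx r
  have b2 := h.exp_neg_re_saddleLine_le hx r
  have b3 := h.norm_log_sub_log_base_le_div hx r
  -- Here $82=11\cdot6+8\cdot2$.
  have e : (82 + 8 * M * √κ + 128 * M ^ 2) * (logPlus x / x) * (1 + r ^ 2)
      = 11 * (6 * (logPlus x / x) * (1 + r ^ 2)) + 8 * (2 * (logPlus x / x) * (1 + r ^ 2))
        + 1 / 4 * ((32 * M * √κ + 512 * M ^ 2) * (logPlus x / x) * (1 + r ^ 2)) := by ring
  rw [e]
  rw [show 11 / ‖saddleLine σ κ x r‖ = 11 * (1 / ‖saddleLine σ κ x r‖) by ring] at h0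
  linarith

end Admissible

/-! ### Saddle-point evaluation of $H_t$ and $H_t'$ for large $\kappa$. -/

theorem deriv_xiLaplace {w : ℂ} (hw : 7 < w.re) :
    deriv xiLaplace w = deriv logXi w * xiLaplace w := by
  have hev : xiLaplace =ᶠ[𝓝 w] fun v => Complex.exp (logXi v) := by
    filter_upwards [(isOpen_lt continuous_const Complex.continuous_re).mem_nhds hw] with v hv
    exact (exp_logXi (le_of_lt hv)).symm
  have hd := (hasDerivAt_logXi hw.le).differentiableAt.hasDerivAt
  rw [hev.deriv_eq, hd.cexp.deriv, exp_logXi hw.le, mul_comm]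

theorem xiLaplace_ne_zero {w : ℂ} (hw : 7 ≤ w.re) : xiLaplace w ≠ 0 := by
  rw [← exp_logXi hw]
  exact Complex.exp_ne_zero _

theorem continuous_deriv_xiLaplace : Continuous (deriv xiLaplace) := by
  show Continuous (deriv (laplace fun u => (Phi u : ℂ)))
  rw [hasExpMoments_Phi.deriv_laplace]
  exact hasExpMoments_Phi.ofReal_mul.differentiable_laplace.continuous

/-- The deviation of `logXi` from its linearisation along the saddle line. -/
def phaseError (σ κ x r : ℝ) : ℂ :=
  logXi (saddleLine σ κ x r) - logXi (saddleLine σ κ x 0) - 2 * Complex.I * σ * slope κ x * r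

namespace Admissible

variable {M σ κ x : ℝ}

theorem seven_lt_re (h : Admissible M σ κ x) (r : ℝ) : 7 < (saddleLine σ κ x r).re := by
  refine lt_of_lt_of_le ?_ (h.le_re_saddleLine r)
  have h1 := h.sqrt_ge.1
  have h2 := h.sq_sqrt
  have h3 := logPlus_ge x
  have : 14400 ≤ κ := by nlinarith
  nlinarith

theorem hasDerivAt_phaseError (h : Admissible M σ κ x) (r : ℝ) :
    HasDerivAt (phaseError σ κ x)
      (2 * Complex.I * σ * (deriv logXi (saddleLine σ κ x r) - slope κ x)) r := by
  have h0 : HasDerivAt (fun r : ℝ => (r : ℂ)) 1 r := Complex.ofRealCLM.hasDerivAt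
  have h1 : HasDerivAt (saddleLine σ κ x) (2 * Complex.I * σ) r := by
    exact ((h0.const_mul (2 * Complex.I * σ)).const_add
      (base κ x - 2 * σ ^ 2 * slope κ x)).congr_deriv (mul_one _)
  have h2 := (hasDerivAt_logXi (h.seven_le_re r)).differentiableAt.hasDerivAt
  have h3 := ((h2.comp r h1).sub_const (logXi (saddleLine σ κ x 0))).sub
    (h0.const_mul (2 * Complex.I * σ * slope κ x))
  refine h3.congr_deriv ?_
  ring

theorem continuous_phaseError (h : Admissible M σ κ x) : Continuous (phaseError σ κ x) :=
  continuous_iff_continuousAt.2 fun r => (h.hasDerivAt_phaseError r).continuousAt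

theorem norm_phaseError_le (h : Admissible M σ κ x) (r : ℝ) :
    ‖phaseError σ κ x r‖ ≤ 1 / 20 * (1 + r ^ 2) := by
  have hM := h.one_le
  have hq := h.sqrt_ge.1
  have hqp : 0 < √κ := by linarith
  have hb : ∀ ρ ∈ Icc (-|r|) |r|,
      ‖2 * Complex.I * σ * (deriv logXi (saddleLine σ κ x ρ) - slope κ x)‖
        ≤ 2 * M * (180 * M / √κ * (1 + |r|)) := fun ρ hρ => by
    rw [norm_mul, norm_mul, norm_mul, Complex.norm_ofNat, Complex.norm_I, Complex.norm_real,
      Real.norm_of_nonneg h.sigma_nonneg, mul_one]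
    have h1 := h.norm_deriv_logXi_sub_slope_le_uniform ρ
    have h2 : |ρ| ≤ |r| := abs_le.2 hρ
    have h3 := h.sigma_le
    gcongr
    refine h1.trans ?_
    gcongr
  have hmv := (convex_Icc (-|r|) |r|).norm_image_sub_le_of_norm_hasDerivWithin_le
    (fun ρ _ => (h.hasDerivAt_phaseError ρ).hasDerivWithinAt) hb
    (x := 0) (y := r) ⟨by simp, by simp⟩ ⟨neg_abs_le r, le_abs_self r⟩
  have h0 : phaseError σ κ x 0 = 0 := by simp [phaseError]
  rw [h0, sub_zero, sub_zero, Real.norm_eq_abs] at hmv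
  refine hmv.trans ?_
  have hrr := abs_le_one_add_sq r
  have hs := sq_abs r
  have e : 2 * M * (180 * M / √κ * (1 + |r|)) * |r| = (360 * M ^ 2 / √κ) * (|r| + r ^ 2) := by
    rw [← hs]; ring
  -- This fixes the constant $14400=360\cdot40$ of `Admissible`.
  have h1 : 360 * M ^ 2 / √κ ≤ 1 / 40 := by
    rw [div_le_div_iff₀ hqp (by norm_num)]
    linarith [h.kappa_ge]
  rw [e]
  calc _ ≤ 1 / 40 * (|r| + r ^ 2) := by gcongr
    _ ≤ _ := by linarith [sq_nonneg r]

/-- With $l=$ `slope` the oscillating linear phase cancels the linear part of `logXi`, leaving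
`phaseError`. -/
theorem exp_mul_xiLaplace (h : Admissible M σ κ x) (r : ℝ) :
    Complex.exp (-(r : ℂ) ^ 2 + (-2 * Complex.I * σ * slope κ x) * r)
        * xiLaplace (saddleLine σ κ x r)
      = xiLaplace (saddleLine σ κ x 0) * Complex.exp (-(r : ℂ) ^ 2 + phaseError σ κ x r) := by
  rw [← exp_logXi (h.seven_le_re r), ← exp_logXi (h.seven_le_re 0), ← Complex.exp_add,
    ← Complex.exp_add, phaseError]
  congr 1
  ring

theorem H_eq (h : Admissible M σ κ x) {z : ℂ} (hz : Complex.I * z = base κ x) :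
    H (-σ ^ 2) z = 1 / 2 * (Complex.exp (σ ^ 2 * slope κ x ^ 2) / (√π : ℝ) *
      xiLaplace (saddleLine σ κ x 0) *
      ∫ r : ℝ, Complex.exp (-(r : ℂ) ^ 2 + phaseError σ κ x r)) := by
  rw [H_eq_gaussian_average σ (slope κ x), hz, mul_assoc (_ / _),
    ← integral_const_mul (xiLaplace (saddleLine σ κ x 0))]
  refine congrArg _ (congrArg _ (integral_congr_ae (Eventually.of_forall fun r => ?_)))
  exact h.exp_mul_xiLaplace r

theorem deriv_H_eq (h : Admissible M σ κ x) {z : ℂ} (hz : Complex.I * z = base κ x) :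
    deriv (H (-σ ^ 2)) z = Complex.I / 2 * (Complex.exp (σ ^ 2 * slope κ x ^ 2) / (√π : ℝ) *
      xiLaplace (saddleLine σ κ x 0) *
      ∫ r : ℝ, Complex.exp (-(r : ℂ) ^ 2 + phaseError σ κ x r)
        * deriv logXi (saddleLine σ κ x r)) := by
  rw [deriv_H_eq_gaussian_average σ (slope κ x), hz, mul_assoc (_ / _),
    ← integral_const_mul (xiLaplace (saddleLine σ κ x 0))]
  refine congrArg _ (congrArg _ (integral_congr_ae (Eventually.of_forall fun r => ?_)))
  simp only
  rw [← mul_assoc, ← h.exp_mul_xiLaplace r, mul_assoc _ (xiLaplace _), mul_comm (xiLaplace _),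
    ← deriv_xiLaplace (h.seven_lt_re r)]
  rfl

theorem norm_integral_sub_le (h : Admissible M σ κ x) :
    ‖(∫ r : ℝ, Complex.exp (-(r : ℂ) ^ 2 + phaseError σ κ x r)) - (√π : ℝ)‖ ≤ √π / 2 :=
  norm_integral_perturbed_gaussian_sub_le h.continuous_phaseError h.norm_phaseError_le

theorem le_norm_integral (h : Admissible M σ κ x) :
    √π / 2 ≤ ‖∫ r : ℝ, Complex.exp (-(r : ℂ) ^ 2 + phaseError σ κ x r)‖ := by
  have h1 := h.norm_integral_sub_le
  have h2 := norm_sub_norm_le ((√π : ℝ) : ℂ)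
    (∫ r : ℝ, Complex.exp (-(r : ℂ) ^ 2 + phaseError σ κ x r))
  rw [norm_sub_rev, Complex.norm_real, Real.norm_of_nonneg (Real.sqrt_nonneg _)] at h2
  linarith

theorem norm_integral_le (h : Admissible M σ κ x) :
    ‖∫ r : ℝ, Complex.exp (-(r : ℂ) ^ 2 + phaseError σ κ x r)‖ ≤ 2 * √π := by
  have h1 := h.norm_integral_sub_le
  have h2 := norm_sub_norm_le (∫ r : ℝ, Complex.exp (-(r : ℂ) ^ 2 + phaseError σ κ x r))
    ((√π : ℝ) : ℂ)
  rw [Complex.norm_real, Real.norm_of_nonneg (Real.sqrt_nonneg _)] at h2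
  linarith [Real.sqrt_nonneg π]

theorem H_ne_zero (h : Admissible M σ κ x) {z : ℂ} (hz : Complex.I * z = base κ x) :
    H (-σ ^ 2) z ≠ 0 := by
  have h0 : 0 < √π := Real.sqrt_pos.2 pi_pos
  have h1 : (∫ r : ℝ, Complex.exp (-(r : ℂ) ^ 2 + phaseError σ κ x r)) ≠ 0 :=
    norm_pos_iff.1 (lt_of_lt_of_le (by positivity) h.le_norm_integral)
  have h2 := xiLaplace_ne_zero (h.seven_le_re 0)
  have h3 : ((√π : ℝ) : ℂ) ≠ 0 := Complex.ofReal_ne_zero.2 h0.ne'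
  have h4 := Complex.exp_ne_zero (σ ^ 2 * slope κ x ^ 2)
  rw [h.H_eq hz]
  simp only [ne_eq, mul_eq_zero, div_eq_zero_iff, h1, h2, h3, h4]
  norm_num

theorem continuous_saddleLine : Continuous (saddleLine σ κ x) := by
  unfold saddleLine
  fun_prop

theorem continuous_deriv_logXi_saddleLine (h : Admissible M σ κ x) :
    Continuous fun r => deriv logXi (saddleLine σ κ x r) := by
  -- Continuity is read off from the quotient of two entire functions with nonvanishing denominator.
  have e : (fun r => deriv logXi (saddleLine σ κ x r))
      = fun r => deriv xiLaplace (saddleLine σ κ x r) / xiLaplace (saddleLine σ κ x r) := by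
    ext r
    rw [deriv_xiLaplace (h.seven_lt_re r), mul_div_cancel_right₀ _
      (xiLaplace_ne_zero (h.seven_le_re r))]
  rw [e]
  exact (continuous_deriv_xiLaplace.comp continuous_saddleLine).div
    (differentiable_xiLaplace.continuous.comp continuous_saddleLine)
    fun r => xiLaplace_ne_zero (h.seven_le_re r)

theorem norm_logDeriv_H_sub_le (h : Admissible M σ κ x) (hx : 0 < x) {z : ℂ}
    (hz : Complex.I * z = base κ x) :
    ‖deriv (H (-σ ^ 2)) z / H (-σ ^ 2) z
        - Complex.I / 4 * Complex.log (Complex.I * z / (4 * π))‖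
      ≤ 20 * (82 + 8 * M * √κ + 128 * M ^ 2) * (logPlus x / x) := by
  set D := (82 + 8 * M * √κ + 128 * M ^ 2) * (logPlus x / x) with hD
  have hD0 : 0 ≤ D := by
    have := h.one_le
    have := logPlus_ge x
    have : 0 ≤ logPlus x / x := div_nonneg (by linarith) hx.le
    positivity
  have hb := h.norm_deriv_logXi_sub_slope_le_div hx
  set I₀ := ∫ r : ℝ, Complex.exp (-(r : ℂ) ^ 2 + phaseError σ κ x r) with hI₀
  have hπ : 0 < √π := Real.sqrt_pos.2 pi_pos
  have hI₀n := h.le_norm_integral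
  have hI₀0 : I₀ ≠ 0 := norm_pos_iff.1 (lt_of_lt_of_le (by positivity) hI₀n)
  have hpc := h.continuous_phaseError
  have hlc := h.continuous_deriv_logXi_saddleLine
  have i0 : Integrable fun r : ℝ => Complex.exp (-(r : ℂ) ^ 2 + phaseError σ κ x r) :=
    Integrable.of_integral_ne_zero hI₀0
  have i1 : Integrable fun r : ℝ => Complex.exp (-(r : ℂ) ^ 2 + phaseError σ κ x r)
      * (deriv logXi (saddleLine σ κ x r) - slope κ x) :=
    (integrable_exp_neg_sq_div_two.const_mul (7 * D)).mono'
      (Continuous.aestronglyMeasurable (by fun_prop))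
      (Eventually.of_forall fun r => norm_perturbed_gaussian_mul_le (h.norm_phaseError_le r)
        hD0 (hb r))
  have hJ : (∫ r : ℝ, Complex.exp (-(r : ℂ) ^ 2 + phaseError σ κ x r)
        * deriv logXi (saddleLine σ κ x r)) = (∫ r : ℝ, Complex.exp (-(r : ℂ) ^ 2
        + phaseError σ κ x r) * (deriv logXi (saddleLine σ κ x r) - slope κ x))
        + I₀ * slope κ x := by
    rw [hI₀, ← integral_mul_const, ← integral_add i1 (i0.mul_const _)]
    refine integral_congr_ae (Eventually.of_forall fun r => ?_)
    simp only
    ring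
  have hbound := norm_integral_perturbed_gaussian_mul_le h.norm_phaseError_le hD0 hb
  set J := ∫ r : ℝ, Complex.exp (-(r : ℂ) ^ 2 + phaseError σ κ x r)
    * (deriv logXi (saddleLine σ κ x r) - slope κ x) with hJdef
  have hE : Complex.exp (σ ^ 2 * slope κ x ^ 2) / (√π : ℝ) * xiLaplace (saddleLine σ κ x 0) ≠ 0 :=
    mul_ne_zero (div_ne_zero (Complex.exp_ne_zero _) (Complex.ofReal_ne_zero.2 hπ.ne'))
      (xiLaplace_ne_zero (h.seven_le_re 0))
  -- The common prefactor cancels and the constant `slope` produces exactly the main term, leaving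
  -- $iJ/I_0$. The factor 20 comes from $\|J\|\le10D\sqrt\pi$ and $\|I_0\|\ge\sqrt\pi/2$.
  have e : deriv (H (-σ ^ 2)) z / H (-σ ^ 2) z
        - Complex.I / 4 * Complex.log (Complex.I * z / (4 * π)) = Complex.I * (J / I₀) := by
    rw [h.H_eq hz, h.deriv_H_eq hz, hJ, hz, ← hI₀,
      show Complex.I / 4 * Complex.log (base κ x / (4 * π)) = Complex.I * slope κ x by
        rw [slope]; ring]
    generalize Complex.exp (σ ^ 2 * slope κ x ^ 2) / (√π : ℝ) * xiLaplace (saddleLine σ κ x 0) = E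
      at hE ⊢
    field_simp
    ring
  rw [e, norm_mul, Complex.norm_I, one_mul, norm_div, mul_assoc 20, ← hD,
    div_le_iff₀ (lt_of_lt_of_le (by positivity) hI₀n)]
  calc ‖J‖ ≤ 10 * D * √π := hbound
    _ = 20 * D * (√π / 2) := by ring
    _ ≤ 20 * D * ‖I₀‖ := by gcongr

/-- The saddle's imaginary part differs from $x$ by $O(\kappa\log_+x)$ and its real part is
$O(\kappa\log_+x)$, so both the displaced main term and the Stirling error are $O(\log_+^2x)$ for
fixed $\kappa$. -/
theorem abs_re_logXi_saddle_add_le (h : Admissible M σ κ x) :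
    |(logXi (saddleLine σ κ x 0)).re + π * x / 8|
      ≤ (12 * (2 + 2 * κ) * (1 + 2 * κ) + 2 * κ) * logPlus x ^ 2 := by
  have h1 := abs_re_logXi_add_le (h.seven_le_re 0)
  have hd := h.norm_sub_base_le 0
  rw [abs_zero, mul_zero, add_zero] at hd
  have hL := logPlus_ge x
  have h7 := h.seven_le_re 0
  have h16 := h.sixteen_mul_le
  have hM := h.one_le
  have hq := h.sqrt_ge.1
  have hx := h.x_nonneg
  have hκ : 1 ≤ κ := by nlinarith
  have h8 : 8 * M * √κ * logPlus x ≤ κ * logPlus x / 2 := by nlinarith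
  have hre := (Complex.abs_re_le_norm _).trans hd
  have him := (Complex.abs_im_le_norm _).trans hd
  rw [Complex.sub_re, base_re] at hre
  rw [Complex.sub_im, base_im] at him
  have hb : ‖base κ x‖ ≤ κ * logPlus x + x := by
    refine (norm_add_le _ _).trans ?_
    rw [norm_mul, Complex.norm_I, one_mul, Complex.norm_real, Complex.norm_real,
      Real.norm_of_nonneg (by positivity), Real.norm_of_nonneg hx]
  have hn : ‖saddleLine σ κ x 0‖ ≤ 2 * κ * logPlus x + x := by
    have := norm_sub_norm_le (saddleLine σ κ x 0) (base κ x)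
    have hp : 0 ≤ κ * logPlus x := by positivity
    linarith
  have hLe : logPlus x = Real.log (2 + x) := by rw [logPlus, abs_of_nonneg hx]
  have hlog : Real.log (2 + ‖saddleLine σ κ x 0‖) ≤ (1 + 2 * κ) * logPlus x := by
    have hp : 0 ≤ κ * logPlus x := by positivity
    have e : 2 + ‖saddleLine σ κ x 0‖ ≤ (2 + x) * (1 + 2 * (κ * logPlus x)) := by
      nlinarith [mul_nonneg hx hp]
    refine (Real.log_le_log (by positivity) e).trans ?_
    rw [Real.log_mul (by positivity) (by positivity), ← hLe]
    have := Real.log_le_sub_one_of_pos (show 0 < 1 + 2 * (κ * logPlus x) by positivity)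
    linarith
  have hre2 : (saddleLine σ κ x 0).re ≤ 2 * κ * logPlus x := by
    have := (abs_le.1 hre).2
    linarith
  generalize saddleLine σ κ x 0 = v at *
  generalize logPlus x = L at *
  have hlog0 : 0 ≤ Real.log (2 + ‖v‖) := Real.log_nonneg (by linarith [norm_nonneg v])
  have hmain : 12 * ((1 + v.re) * Real.log (2 + ‖v‖)) ≤ 12 * (2 + 2 * κ) * (1 + 2 * κ) * L ^ 2 := by
    have : 1 + v.re ≤ (2 + 2 * κ) * L := by linarith
    calc 12 * ((1 + v.re) * Real.log (2 + ‖v‖)) ≤ 12 * (((2 + 2 * κ) * L) * ((1 + 2 * κ) * L)) := by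
          gcongr
      _ = _ := by ring
  have him2 : |π * |v.im| / 8 - π * x / 8| ≤ 2 * κ * L ^ 2 := by
    have e1 : |π * |v.im| / 8 - π * x / 8| = π / 8 * |(|v.im| - |x|)| := by
      rw [abs_of_nonneg hx, show π * |v.im| / 8 - π * x / 8 = π / 8 * (|v.im| - x) by ring, abs_mul,
        abs_of_pos (by positivity)]
    have e2 : |(|v.im| - |x|)| ≤ κ * L / 2 := (abs_abs_sub_abs_le _ _).trans (by linarith)
    have hpi := pi_le_four
    have hpi' := pi_pos
    rw [e1]
    calc π / 8 * |(|v.im| - |x|)| ≤ 4 / 8 * (κ * L / 2) := by gcongr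
      _ ≤ 2 * κ * L ^ 2 := by
        have : L ≤ 2 * L ^ 2 := by nlinarith
        nlinarith
  rw [abs_le] at h1 him2 ⊢
  constructor <;> linarith

theorem abs_log_norm_H_add_le (h : Admissible M σ κ x) {z : ℂ} (hz : Complex.I * z = base κ x) :
    |Real.log ‖H (-σ ^ 2) z‖ + π * x / 8|
      ≤ (8 + 16 * M * κ + 12 * (2 + 2 * κ) * (1 + 2 * κ) + 2 * κ) * logPlus x ^ 2 := by
  have h1 := h.abs_re_logXi_saddle_add_le
  have hπ : 0 < √π := Real.sqrt_pos.2 pi_pos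
  have hI1 := h.le_norm_integral
  have hI2 := h.norm_integral_le
  have hIp := lt_of_lt_of_le (by positivity : 0 < √π / 2) hI1
  have hL := logPlus_ge x
  have hs := h.norm_slope_le
  have hκ := h.sq_sqrt
  have hM := h.one_le
  rw [h.H_eq hz, ← exp_logXi (h.seven_le_re 0)]
  set I₀ := ‖∫ r : ℝ, Complex.exp (-(r : ℂ) ^ 2 + phaseError σ κ x r)‖ with hI₀
  have e : Real.log ‖1 / 2 * (Complex.exp (σ ^ 2 * slope κ x ^ 2) / (√π : ℝ) *
      Complex.exp (logXi (saddleLine σ κ x 0)) *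
      ∫ r : ℝ, Complex.exp (-(r : ℂ) ^ 2 + phaseError σ κ x r))‖
      = -Real.log 2 + (σ ^ 2 * slope κ x ^ 2 : ℂ).re + (logXi (saddleLine σ κ x 0)).re
        + Real.log (I₀ / √π) := by
    rw [norm_mul (1 / 2 : ℂ), show ‖(1 / 2 : ℂ)‖ = 2⁻¹ by norm_num, norm_mul, norm_mul, norm_div,
      Complex.norm_exp, Complex.norm_exp, ← hI₀, Complex.norm_real, Real.norm_of_nonneg hπ.le,
      Real.log_mul (by norm_num) (by positivity), Real.log_mul (by positivity) (by positivity),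
      Real.log_mul (by positivity) (by positivity), Real.log_div (by positivity) (by positivity),
      Real.log_div (by positivity) (by positivity), Real.log_exp, Real.log_exp, Real.log_inv]
    ring
  have b1 : |(σ ^ 2 * slope κ x ^ 2 : ℂ).re| ≤ 16 * M * κ * logPlus x ^ 2 := by
    refine (Complex.abs_re_le_norm _).trans ?_
    rw [norm_mul, norm_pow, norm_pow, Complex.norm_real, Real.norm_of_nonneg h.sigma_nonneg]
    calc σ ^ 2 * ‖slope κ x‖ ^ 2 ≤ M * (4 * √κ * logPlus x) ^ 2 := by
          have := h.sq_le
          gcongr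
      _ = 16 * M * √κ ^ 2 * logPlus x ^ 2 := by ring
      _ = _ := by rw [hκ]
  have b2 : |Real.log (I₀ / √π)| ≤ Real.log 2 := by
    have l1 : 1 / 2 ≤ I₀ / √π := by rw [le_div_iff₀ hπ]; linarith
    have l2 : I₀ / √π ≤ 2 := by rw [div_le_iff₀ hπ]; linarith
    rw [abs_le]
    constructor
    · have := Real.log_le_log (by norm_num) l1
      rwa [one_div, Real.log_inv] at this
    · exact Real.log_le_log (by positivity) l2
  have b3 : 2 ≤ 8 * logPlus x ^ 2 := by nlinarith
  have b4 := Real.log_two_lt_d9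
  have b5 := Real.log_two_gt_d9
  rw [e]
  rw [abs_le] at h1 b1 b2 ⊢
  constructor <;> linarith

end Admissible

/-! ### Phragmén–Lindelöf bound for `xiLaplace` in the critical strip. -/

theorem norm_xiLaplace_le_of_seven_le {w : ℂ} (hw : 7 ≤ w.re) :
    ‖xiLaplace w‖ ≤ Real.exp (-(π * |w.im| / 8) + 12 * ((1 + w.re) * Real.log (2 + ‖w‖))) := by
  rw [← exp_logXi hw, Complex.norm_exp]
  refine Real.exp_le_exp.2 ?_
  have := (abs_le.1 (abs_re_logXi_add_le hw)).2
  linarith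

/-- The exponent is $96=12\cdot(1+7)$. -/
theorem norm_xiLaplace_le_of_re_eq_seven {w : ℂ} (hw : w.re = 7) :
    ‖xiLaplace w‖ ≤ Real.exp (-(π * |w.im| / 8)) * (9 + |w.im|) ^ 96 := by
  refine (norm_xiLaplace_le_of_seven_le hw.ge).trans ?_
  rw [Real.exp_add]
  have h1 : ‖w‖ ≤ 7 + |w.im| := by
    have := Complex.norm_le_abs_re_add_abs_im w
    rwa [hw, abs_of_pos (by norm_num : (0 : ℝ) < 7)] at this
  have h2 : Real.exp (12 * ((1 + w.re) * Real.log (2 + ‖w‖))) = (2 + ‖w‖) ^ 96 := by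
    rw [hw, ← Real.exp_log (show 0 < 2 + ‖w‖ by positivity), ← Real.exp_nat_mul, Real.log_exp]
    norm_num
    ring
  rw [h2]
  exact mul_le_mul_of_nonneg_left (pow_le_pow_left₀ (by positivity) (by linarith) _)
    (Real.exp_pos _).le

theorem norm_xiLaplace_le_const {w : ℂ} (hw : |w.re| ≤ 7) :
    ‖xiLaplace w‖ ≤ ∫ u : ℝ, ‖(Phi u : ℂ)‖ * Real.exp (7 * |u|) :=
  norm_integral_le_of_norm_le (hasExpMoments_Phi.2 7)
    (Eventually.of_forall fun _ => norm_mul_cexp_le _ _ _ hw)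

theorem norm_cexp_neg_I_mul (w : ℂ) :
    ‖Complex.exp (-Complex.I * (π / 8) * w)‖ = Real.exp (π * w.im / 8) := by
  rw [Complex.norm_exp]
  congr 1
  simp
  ring

theorem le_norm_add_sixteen {w : ℂ} (hw : |w.re| ≤ 7) : (9 + |w.im|) / 2 ≤ ‖w + 16‖ := by
  have h1 := Complex.re_le_norm (w + 16)
  have h2 := Complex.abs_im_le_norm (w + 16)
  simp only [Complex.add_re, Complex.add_im, Complex.re_ofNat, Complex.im_ofNat, add_zero]
    at h1 h2
  have := (abs_le.1 hw).1
  linarith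

/-- The function to which the Phragmen–Lindelöf principle is applied. -/
def stripFunction (w : ℂ) : ℂ :=
  xiLaplace w * Complex.exp (-Complex.I * (π / 8) * w) / (w + 16) ^ 96

/-- The edge $\Re w=-7$ follows from $\Re w=7$ by evenness. The exponential factor compensates the
decay for $\Im w>0$ and only helps for $\Im w<0$. -/
theorem norm_stripFunction_le {w : ℂ} (hw : |w.re| = 7) : ‖stripFunction w‖ ≤ 2 ^ 96 := by
  have hx : ‖xiLaplace w‖ ≤ Real.exp (-(π * |w.im| / 8)) * (9 + |w.im|) ^ 96 := by
    rcases abs_eq (by norm_num : (0 : ℝ) ≤ 7) |>.1 hw with h | h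
    · exact norm_xiLaplace_le_of_re_eq_seven h
    · have := norm_xiLaplace_le_of_re_eq_seven (w := -w) (by simp [h])
      rwa [xiLaplace_neg, Complex.neg_im, abs_neg] at this
  have hd := le_norm_add_sixteen hw.le
  have hdp : 0 < ‖w + 16‖ := lt_of_lt_of_le (by positivity) hd
  rw [stripFunction, norm_div, norm_mul, norm_cexp_neg_I_mul, norm_pow,
    div_le_iff₀ (by positivity), ← mul_pow]
  have he : Real.exp (-(π * |w.im| / 8)) * Real.exp (π * w.im / 8) ≤ 1 := by
    rw [← Real.exp_add, Real.exp_le_one_iff]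
    have : π * w.im ≤ π * |w.im| := mul_le_mul_of_nonneg_left (le_abs_self _) pi_pos.le
    linarith
  calc ‖xiLaplace w‖ * Real.exp (π * w.im / 8)
      ≤ (Real.exp (-(π * |w.im| / 8)) * (9 + |w.im|) ^ 96) * Real.exp (π * w.im / 8) := by gcongr
    _ = (Real.exp (-(π * |w.im| / 8)) * Real.exp (π * w.im / 8)) * (9 + |w.im|) ^ 96 := by ring
    _ ≤ 1 * (9 + |w.im|) ^ 96 := by gcongr
    _ ≤ (2 * ‖w + 16‖) ^ 96 := by
      rw [one_mul]
      gcongr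
      linarith

theorem diffContOnCl_stripFunction :
    DiffContOnCl ℂ stripFunction (Complex.re ⁻¹' Ioo (-7) 7) := by
  refine DifferentiableOn.diffContOnCl fun w hw => ?_
  have hcl : w ∈ Complex.re ⁻¹' Icc (-7) 7 := by
    refine closure_minimal (preimage_mono Ioo_subset_Icc_self) ?_ hw
    exact isClosed_Icc.preimage Complex.continuous_re
  have h0 : w + 16 ≠ 0 := by
    have := le_norm_add_sixteen (abs_le.2 hcl)
    exact norm_pos_iff.1 (lt_of_lt_of_le (by positivity) this)
  have hx : DifferentiableAt ℂ xiLaplace w := differentiable_xiLaplace w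
  refine DifferentiableAt.differentiableWithinAt ?_
  unfold stripFunction
  exact (hx.mul (by fun_prop)).div (by fun_prop) (pow_ne_zero _ h0)

/-- In the strip `xiLaplace` is bounded by an absolute exponential moment of $\Phi$, so the function
grows at most like $e^{\pi|\Im w|/8}$, well below the double exponential rate allowed in width 14
($\frac18<\frac\pi{14}$). -/
theorem norm_stripFunction_le_of_mem_strip {w : ℂ} (hw : |w.re| ≤ 7) :
    ‖stripFunction w‖ ≤ 2 ^ 96 := by
  refine PhragmenLindelof.vertical_strip diffContOnCl_stripFunction ⟨1 / 8, ?_, 4, ?_⟩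
    (fun z hz => norm_stripFunction_le (by rw [hz]; norm_num))
    (fun z hz => norm_stripFunction_le (by rw [hz]; norm_num)) (abs_le.1 hw).1 (abs_le.1 hw).2
  · have := pi_gt_three
    linarith
  · set B := ∫ u : ℝ, ‖(Phi u : ℂ)‖ * Real.exp (7 * |u|) with hB
    refine Asymptotics.IsBigO.of_bound B ?_
    refine eventually_inf_principal.2 (Eventually.of_forall fun z hz => ?_)
    have hz' : |z.re| ≤ 7 := abs_le.2 ⟨hz.1.le, hz.2.le⟩
    have h1 := norm_xiLaplace_le_const hz'
    rw [← hB] at h1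
    have hd : 1 ≤ ‖z + 16‖ := by
      have := le_norm_add_sixteen hz'
      have := abs_nonneg z.im
      linarith
    rw [stripFunction, norm_div, norm_mul, norm_cexp_neg_I_mul, norm_pow, Real.norm_eq_abs,
      Real.abs_exp]
    have he : Real.exp (π * z.im / 8) ≤ Real.exp (4 * Real.exp (1 / 8 * |z.im|)) := by
      refine Real.exp_le_exp.2 ?_
      have e1 := Real.add_one_le_exp (1 / 8 * |z.im|)
      have e2 : π * z.im ≤ 4 * |z.im| :=
        (mul_le_mul_of_nonneg_left (le_abs_self _) pi_pos.le).trans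
          (mul_le_mul_of_nonneg_right pi_le_four (abs_nonneg _))
      linarith
    calc _ ≤ ‖xiLaplace z‖ * Real.exp (π * z.im / 8) :=
          div_le_self (by positivity) (one_le_pow₀ hd)
      _ ≤ _ := by gcongr

theorem norm_xiLaplace_le {w : ℂ} (hw : 0 ≤ w.re) :
    ‖xiLaplace w‖
      ≤ Real.exp (-(π * w.im / 8) + 600 * ((1 + w.re) * Real.log (2 + |w.im| + w.re))) := by
  have ha := abs_nonneg w.im
  have hlog : 0 ≤ Real.log (2 + |w.im| + w.re) := Real.log_nonneg (by linarith)
  rcases le_or_gt 7 w.re with h7 | h7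
  · refine (norm_xiLaplace_le_of_seven_le h7).trans (Real.exp_le_exp.2 ?_)
    have h1 : Real.log (2 + ‖w‖) ≤ Real.log (2 + |w.im| + w.re) := by
      refine Real.log_le_log (by positivity) ?_
      have := Complex.norm_le_abs_re_add_abs_im w
      rw [abs_of_nonneg hw] at this
      linarith
    have h2 : π * w.im ≤ π * |w.im| := mul_le_mul_of_nonneg_left (le_abs_self _) pi_pos.le
    have h3 : (1 + w.re) * Real.log (2 + ‖w‖) ≤ (1 + w.re) * Real.log (2 + |w.im| + w.re) := by
      gcongr
    have h4 : 0 ≤ (1 + w.re) * Real.log (2 + |w.im| + w.re) := by positivity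
    linarith
  · have hre : |w.re| ≤ 7 := abs_le.2 ⟨by linarith, h7.le⟩
    have h1 := norm_stripFunction_le_of_mem_strip hre
    have hd := le_norm_add_sixteen hre
    have hdp : 0 < ‖w + 16‖ := lt_of_lt_of_le (by positivity) hd
    rw [stripFunction, norm_div, norm_mul, norm_cexp_neg_I_mul, norm_pow,
      div_le_iff₀ (by positivity), ← mul_pow] at h1
    -- Together with the power 96 this gives $6\cdot96=576\le600$.
    have h2 : 2 * ‖w + 16‖ ≤ (2 + |w.im| + w.re) ^ 6 := by
      have e1 : ‖w + 16‖ ≤ 16 + (|w.im| + w.re) := by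
        refine (norm_add_le _ _).trans ?_
        have := Complex.norm_le_abs_re_add_abs_im w
        rw [abs_of_nonneg hw] at this
        rw [Complex.norm_ofNat]
        linarith
      have e2 : (2 : ℝ) ^ 5 * (2 + (|w.im| + w.re)) ≤ (2 + |w.im| + w.re) ^ 6 := by
        rw [pow_succ _ 5, ← add_assoc]
        exact mul_le_mul_of_nonneg_right (pow_le_pow_left₀ (by norm_num) (by linarith) _)
          (by positivity)
      linarith
    have h3 : (2 * ‖w + 16‖) ^ 96 ≤ Real.exp (600 * ((1 + w.re) * Real.log (2 + |w.im| + w.re))) := by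
      calc (2 * ‖w + 16‖) ^ 96 ≤ ((2 + |w.im| + w.re) ^ 6) ^ 96 := by gcongr
        _ = Real.exp (576 * Real.log (2 + |w.im| + w.re)) := by
          rw [← pow_mul]
          nth_rw 1 [← Real.exp_log (show 0 < 2 + |w.im| + w.re by positivity)]
          rw [← Real.exp_nat_mul]
          norm_num
        _ ≤ _ := by
          refine Real.exp_le_exp.2 ?_
          have : 0 ≤ w.re * Real.log (2 + |w.im| + w.re) := by positivity
          linarith
    rw [Real.exp_add, Real.exp_neg, ← div_eq_inv_mul, le_div_iff₀ (Real.exp_pos _)]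
    exact h1.trans h3

/-! ### Upper bound for $H_t$ valid for all $\kappa\ge0$. -/

theorem norm_H_le {M σ : ℝ} (hσ : 0 ≤ σ) (hσM : σ ^ 2 ≤ M) {w z : ℂ}
    (hz : Complex.I * z = w) (hw : 0 ≤ w.re) (hx : 0 ≤ w.im) :
    ‖H (-σ ^ 2) z‖ ≤ Real.exp (-(π * w.im / 8)
      + (600 * ((1 + w.re) * Real.log (2 + w.im + w.re)) + 200000 * M * (1 + w.re) ^ 2)) := by
  set y := w.re with hy
  set x := w.im with hxdef
  set N := -(π * x / 8) + 600 * ((1 + y) * Real.log (2 + x + y)) with hN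
  -- Moving by $2\sigma r$ along the line changes the exponent by at most
  -- $P|r|\le\frac12P^2+\frac12r^2$: 600 from the logarithm, 1 from $\pi/4\le1$. Half of the
  -- Gaussian is kept for convergence, and $601^2/2\le200000$.
  set P := 601 * (1 + y) * σ with hP
  have hbd : ∀ r : ℝ, ‖Complex.exp (-(r : ℂ) ^ 2 + (-2 * Complex.I * σ * 0) * r) *
      xiLaplace (w - 2 * σ ^ 2 * 0 + 2 * Complex.I * σ * r)‖
      ≤ Real.exp (N + P ^ 2 / 2) * Real.exp (-(1 / 2) * r ^ 2) := fun r => by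
    have hre : (w - 2 * σ ^ 2 * 0 + 2 * Complex.I * σ * r).re = y := by simp [hy]
    have him : (w - 2 * σ ^ 2 * 0 + 2 * Complex.I * σ * r).im = x + 2 * σ * r := by simp [hxdef]
    have h1 := norm_xiLaplace_le (w := w - 2 * σ ^ 2 * 0 + 2 * Complex.I * σ * r)
      (by rw [hre]; exact hw)
    rw [hre, him] at h1
    have hexp : ‖Complex.exp (-(r : ℂ) ^ 2 + (-2 * Complex.I * σ * 0) * r)‖
        = Real.exp (-r ^ 2) := by
      rw [mul_zero, zero_mul, add_zero, ← Complex.ofReal_pow, ← Complex.ofReal_neg,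
        ← Complex.ofReal_exp, Complex.norm_real, Real.norm_eq_abs, Real.abs_exp]
    have hsr : |x + 2 * σ * r| ≤ x + 2 * σ * |r| := by
      refine (abs_add_le _ _).trans ?_
      rw [abs_of_nonneg hx, abs_mul, abs_of_nonneg (by positivity : 0 ≤ 2 * σ)]
    have hr0 := abs_nonneg r
    have hσr : 0 ≤ σ * |r| := by positivity
    have hlog : Real.log (2 + |x + 2 * σ * r| + y) ≤ Real.log (2 + x + y) + σ * |r| := by
      have e : 2 + |x + 2 * σ * r| + y ≤ (2 + x + y) * (1 + σ * |r|) := by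
        nlinarith [mul_nonneg hx hσr, mul_nonneg hw hσr]
      refine (Real.log_le_log (by positivity) e).trans ?_
      rw [Real.log_mul (by positivity) (by positivity)]
      have := Real.log_le_sub_one_of_pos (show 0 < 1 + σ * |r| by positivity)
      linarith
    have hlog2 : (1 + y) * Real.log (2 + |x + 2 * σ * r| + y)
        ≤ (1 + y) * (Real.log (2 + x + y) + σ * |r|) := by gcongr
    have hpi : -(π * (x + 2 * σ * r) / 8) ≤ -(π * x / 8) + σ * |r| := by
      have e1 : -(σ * r) ≤ σ * |r| := by
        have := neg_abs_le r
        nlinarith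
      have := pi_le_four
      have := pi_pos
      nlinarith
    have hPr : P * |r| ≤ P ^ 2 / 2 + r ^ 2 / 2 := by
      have := sq_abs r
      nlinarith [sq_nonneg (P - |r|)]
    have hPe : P * |r| = 600 * ((1 + y) * (σ * |r|)) + (1 + y) * (σ * |r|) := by rw [hP]; ring
    have hy1 : σ * |r| ≤ (1 + y) * (σ * |r|) := le_mul_of_one_le_left hσr (by linarith)
    rw [norm_mul, hexp, ← Real.exp_add]
    refine (mul_le_mul_of_nonneg_left h1 (Real.exp_pos _).le).trans ?_
    rw [← Real.exp_add]
    refine Real.exp_le_exp.2 ?_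
    rw [hN]
    linarith
  rw [H_eq_gaussian_average σ 0 z, hz, norm_mul (1 / 2 : ℂ),
    show ‖(1 / 2 : ℂ)‖ = 1 / 2 by norm_num, norm_mul, norm_div]
  have hint := norm_integral_le_of_norm_le (integrable_exp_neg_sq_div_two.const_mul _)
    (Eventually.of_forall hbd)
  rw [integral_const_mul, integral_exp_neg_sq_div_two] at hint
  have hπ : 0 < √π := Real.sqrt_pos.2 pi_pos
  rw [show ‖Complex.exp (σ ^ 2 * 0 ^ 2)‖ = 1 by simp, Complex.norm_real,
    Real.norm_of_nonneg hπ.le]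
  have hP2 : P ^ 2 / 2 ≤ 200000 * M * (1 + y) ^ 2 := by
    have e : P ^ 2 / 2 = 601 ^ 2 / 2 * σ ^ 2 * (1 + y) ^ 2 := by rw [hP]; ring
    rw [e]
    gcongr
    linarith
  calc _ ≤ 1 / 2 * (1 / √π * (Real.exp (N + P ^ 2 / 2) * (√2 * √π))) := by gcongr
    _ = (√2 / 2) * Real.exp (N + P ^ 2 / 2) := by field_simp
    _ ≤ 1 * Real.exp (N + P ^ 2 / 2) := by
      gcongr
      linarith [sqrt_two_le]
    _ ≤ _ := by
      rw [one_mul]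
      refine Real.exp_le_exp.2 ?_
      linarith

theorem norm_H_base_le {M σ κ x C : ℝ} (hσ : 0 ≤ σ) (hσM : σ ^ 2 ≤ M) (hx : 0 ≤ x)
    (hκ : 0 ≤ κ) (hκC : κ ≤ C) {z : ℂ} (hz : Complex.I * z = base κ x) :
    ‖H (-σ ^ 2) z‖ ≤ Real.exp (-(π * x / 8)
      + (600 * (2 + C) * (1 + C) + 200000 * M * (2 + C) ^ 2) * logPlus x ^ 2) := by
  have hL := logPlus_ge x
  have hM : 0 ≤ M := (sq_nonneg σ).trans hσM
  have hC : 0 ≤ C := hκ.trans hκC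
  have h := norm_H_le hσ hσM hz (by rw [Admissible.base_re]; positivity)
    (by rw [Admissible.base_im]; exact hx)
  rw [Admissible.base_re, Admissible.base_im] at h
  refine h.trans (Real.exp_le_exp.2 (add_le_add_right ?_ _))
  have hLe : logPlus x = Real.log (2 + x) := by rw [logPlus, abs_of_nonneg hx]
  have hp : 0 ≤ κ * logPlus x := by positivity
  have hκL : κ * logPlus x ≤ C * logPlus x := by gcongr
  have hlog : Real.log (2 + x + κ * logPlus x) ≤ (1 + C) * logPlus x := by
    have e : 2 + x + κ * logPlus x ≤ (2 + x) * (1 + κ * logPlus x) := by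
      nlinarith [mul_nonneg hx hp]
    refine (Real.log_le_log (by positivity) e).trans ?_
    rw [Real.log_mul (by positivity) (by positivity), ← hLe]
    have := Real.log_le_sub_one_of_pos (show 0 < 1 + κ * logPlus x by positivity)
    linarith
  have hlog0 : 0 ≤ Real.log (2 + x + κ * logPlus x) := Real.log_nonneg (by linarith)
  have h1 : 1 + κ * logPlus x ≤ (2 + C) * logPlus x := by linarith
  calc _ ≤ 600 * (((2 + C) * logPlus x) * ((1 + C) * logPlus x))
        + 200000 * M * ((2 + C) * logPlus x) ^ 2 := by gcongr
    _ = _ := by ring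

end

end DeBruijnNewman

/-! ### Choice of constants and conclusion. -/

theorem lemma2p1 (Λ : ℝ) :
    ∃ A : ℝ, 0 < A ∧ ∃ C' : ℝ, 0 < C' ∧ ∀ C : ℝ, ∃ K : ℝ,
      ∀ t x κ : ℝ, Λ < t → t ≤ 0 → 0 ≤ x → 0 ≤ κ → κ ≤ C →
        ∀ z : ℂ, z = (x : ℂ) - Complex.I * ((κ * DeBruijnNewman.logPlus x : ℝ) : ℂ) →
          ‖DeBruijnNewman.H t z‖
              ≤ A * Real.exp (-(Real.pi * x / 8) + K * DeBruijnNewman.logPlus x ^ 2) ∧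
          (C' ≤ κ →
            (∃ w : ℂ, ‖w‖ ≤ K * DeBruijnNewman.logPlus x ^ 2 ∧
              DeBruijnNewman.H t z
                = Complex.exp (-((Real.pi : ℂ) * (x : ℂ) / 8) + w)) ∧
            (0 < x →
              ‖deriv (DeBruijnNewman.H t) z / DeBruijnNewman.H t z
                  - Complex.I / 4 * Complex.log (Complex.I * z / (4 * (Real.pi : ℂ)))‖
                ≤ K * (DeBruijnNewman.logPlus x / x))) := by
  set M : ℝ := |Λ| + 1 with hMdef
  have hM : 1 ≤ M := by linarith [abs_nonneg Λ]
  -- $M$ bounds $\sigma^2=-t<-\Lambda$, and $\kappa\ge C'$ means $\sqrt\kappa\ge14400M^2$, as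
  -- `Admissible` requires.
  refine ⟨1, one_pos, (14400 * M ^ 2) ^ 2, by positivity, fun C => ?_⟩
  -- $K_1,K_2,K_3$ serve the three estimates; $|C|$ makes them nonnegative, so that their sum serves
  -- all at once.
  set D : ℝ := |C| with hD
  have hD0 : 0 ≤ D := abs_nonneg C
  set K₁ : ℝ := 600 * (2 + D) * (1 + D) + 200000 * M * (2 + D) ^ 2 with hK₁
  set K₂ : ℝ := 8 + 16 * M * D + 12 * (2 + 2 * D) * (1 + 2 * D) + 2 * D + 16 with hK₂
  set K₃ : ℝ := 20 * (82 + 8 * M * √D + 128 * M ^ 2) with hK₃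
  have p1 : 0 ≤ K₁ := by positivity
  have p2 : 0 ≤ K₂ := by positivity
  have p3 : 0 ≤ K₃ := by positivity
  refine ⟨K₁ + K₂ + K₃, fun t x κ hΛt ht hx hκ hκC z hz => ?_⟩
  have hL := DeBruijnNewman.logPlus_ge x
  have hκD : κ ≤ D := hκC.trans (le_abs_self C)
  have hIz : Complex.I * z = DeBruijnNewman.base κ x := by
    rw [hz, DeBruijnNewman.base]
    linear_combination (-((κ * DeBruijnNewman.logPlus x : ℝ) : ℂ)) * Complex.I_sq
  have hσ2 : √(-t) ^ 2 = -t := Real.sq_sqrt (by linarith)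
  have hσM : √(-t) ^ 2 ≤ M := by
    rw [hσ2]
    linarith [neg_abs_le Λ]
  have hσ0 := Real.sqrt_nonneg (-t)
  have htσ : t = -√(-t) ^ 2 := by rw [hσ2, neg_neg]
  rw [htσ]
  generalize √(-t) = σ at *
  refine ⟨?_, fun hC' => ?_⟩
  · rw [one_mul]
    refine (DeBruijnNewman.norm_H_base_le hσ0 hσM hx hκ hκD hIz).trans (Real.exp_le_exp.2 ?_)
    exact add_le_add_right (mul_le_mul_of_nonneg_right (by linarith) (sq_nonneg _)) _
  · have hadm : DeBruijnNewman.Admissible M σ κ x :=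
      ⟨hM, hσ0, hσM, Real.le_sqrt_of_sq_le hC', hx⟩
    -- With the principal logarithm the imaginary part of $w$ is at most $\pi\le4\le16\log_+^2x$,
    -- which is the final 16 in $K_2$.
    refine ⟨⟨Complex.log (DeBruijnNewman.H (-σ ^ 2) z) + Real.pi * x / 8, ?_, ?_⟩, fun hx0 => ?_⟩
    · have h1 := hadm.abs_log_norm_H_add_le hIz
      refine (Complex.norm_le_abs_re_add_abs_im _).trans ?_
      have e : ((Real.pi : ℂ) * x / 8) = ((Real.pi * x / 8 : ℝ) : ℂ) := by push_cast; rfl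
      rw [e, Complex.add_re, Complex.add_im, Complex.ofReal_re, Complex.ofReal_im, add_zero,
        Complex.log_re, Complex.log_im]
      have h2 := Complex.abs_arg_le_pi (DeBruijnNewman.H (-σ ^ 2) z)
      have h3 := Real.pi_le_four
      have h4 : 4 ≤ 16 * DeBruijnNewman.logPlus x ^ 2 := by nlinarith
      have h5 : (8 + 16 * M * κ + 12 * (2 + 2 * κ) * (1 + 2 * κ) + 2 * κ)
          ≤ (8 + 16 * M * D + 12 * (2 + 2 * D) * (1 + 2 * D) + 2 * D) := by gcongr
      calc _ ≤ (8 + 16 * M * κ + 12 * (2 + 2 * κ) * (1 + 2 * κ) + 2 * κ)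
            * DeBruijnNewman.logPlus x ^ 2 + 16 * DeBruijnNewman.logPlus x ^ 2 := by linarith
        _ ≤ (8 + 16 * M * D + 12 * (2 + 2 * D) * (1 + 2 * D) + 2 * D)
            * DeBruijnNewman.logPlus x ^ 2 + 16 * DeBruijnNewman.logPlus x ^ 2 := by gcongr
        _ = K₂ * DeBruijnNewman.logPlus x ^ 2 := by rw [hK₂]; ring
        _ ≤ _ := by gcongr; linarith
    · rw [show -((Real.pi : ℂ) * x / 8) + (Complex.log (DeBruijnNewman.H (-σ ^ 2) z)
        + Real.pi * x / 8) = Complex.log (DeBruijnNewman.H (-σ ^ 2) z) by ring,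
        Complex.exp_log (hadm.H_ne_zero hIz)]
    · refine (hadm.norm_logDeriv_H_sub_le hx0 hIz).trans ?_
      have h0 : 0 ≤ DeBruijnNewman.logPlus x / x := div_nonneg (by linarith) hx
      refine mul_le_mul_of_nonneg_right ?_ h0
      have : 20 * (82 + 8 * M * √κ + 128 * M ^ 2) ≤ K₃ := by
        rw [hK₃]
        gcongr
      linarith
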